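/- **Setting.** Let $t\ge 0$, $[t]=\{0,\dots,t-1\}$, and let $S_t$ be the group of permutations of $[t]$. For $\sigma\in S_t$ let $\Gamma_\sigma=\{i:\sigma(i)\ne i\}$ be its support, $l_\sigma=|\Gamma_\sigma|$, and $|\sigma|$ the least number of transpositions whose product is $\sigma$. Write $\lambda\in\sigma$ for the nontrivial cycles $\lambda$ of $\sigma$; such a cycle has length $l_\lambda=|\lambda|+1$. Call $\pi$ a sub-permutation of $\sigma$, $\pi\subseteq\sigma$, if $|\pi^{-1}\sigma|=|\sigma|-|\pi|$. Let $c_l=\frac1{l+1}\binom{2l}{l}$ be the Catalan numbers, $c(\sigma)=\prod_{\lambda\in\sigma}c_{l_\lambda}$, $\mu(\sigma)=\prod_{\lambda\in\sigma}(-1)^{|\lambda|}c_{|\lambda|}$, and let $!l$ be the number of derangements of $l$ points. Define the integer matrices, indexed by $S_t\times S_t$, $$\phi_t(\sigma,\pi)=\mu(\pi^{-1}\sigma)\,\delta_{\sigma\supseteq\pi},\qquad \zeta_t(\sigma,\pi)=\delta_{\sigma\supseteq\pi}.$$ For $d\ge1$ let $R_\sigma$ be the operator on $(\mathbb C^d)^{\otimes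 t}$ that permutes the tensor factors according to $\sigma$, let $\chi(X,Y)=d^{-t}\operatorname{Tr}[X^\dagger Y]$, and define the character-normalized permutations $N_\sigma=R_\sigma/\chi(I,R_\sigma)$ and the localized permutations $$L_\sigma=\sum_{\pi\subseteq\sigma}\phi_t(\sigma,\pi)\,N_\pi .$$ Let $\mathcal P$ be any basis of the operators on $\mathbb C^d$ that contains the identity and is orthonormal for $d^{-1}\operatorname{Tr}[X^\dagger Y]$. A string $P=\bigotimes_{i\in[t]}P_i$ with $P_i\in\mathcal P$ has support $\Gamma_P=\{i:P_i\neq I\}$; the support $\Gamma_X$ of an operator $X$ on $(\mathbb C^d)^{\otimes t}$ is the union of the supports of the strings $P$ with $\chi(P,X)\ne0$. **Theorem (Localized basis for permutations).** 1. *Counting.* $c_l\le l!$ for all $l\ge0$. A cycle of length $l$ in $S_t$ has exactly $c_l$ sub-permutations, and every $\sigma\in S_t$ has exactly $c(\sigma)$ sub-permutations, with $c(\sigma)\le c_{l_\sigma}$. There are $\binom tl$ subsets $\Gamma\subseteq[t]$ of size $l$; for each of them exactly $!l$ permutations have support $\Gamma$; $!l=\lfloor l!/e+\tfrac12\rfloor$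 for $l\ge1$; and $t!=\sum_{0\le l\le t,\ l\ne1}\binom tl\,!l$. 2. *Change of basis.* The relation $\subseteq$ is a partial order on $S_t$. The matrix $\phi_t$, which does not depend on $d$, has unit diagonal and is lower triangular with respect to every enumeration of $S_t$ that is monotone for $\subseteq$ (and such enumerations exist); it is invertible, with $\phi_t^{-1}=\zeta_t$. For every $d\ge1$ and all $\sigma$, $N_\sigma=\sum_{\pi\subseteq\sigma}L_\pi$; more generally, a family of operators $(L'_\sigma)_{\sigma\in S_t}$ satisfies $N_\sigma=\sum_{\pi\subseteq\sigma}L'_\pi$ for all $\sigma$ if and only if $L'_\sigma=\sum_{\pi\subseteq\sigma}\phi_t(\sigma,\pi)N_\pi$ for all $\sigma$. The families $(L_\sigma)$ and $(N_\sigma)$ have the same linear span. 3. *Linear independence.* If $d\ge t$ (and $d\geq 1$), the operators $L_\sigma$, $\sigma\in S_t$, are linearly independent, and $\sigma\mapsto L_\sigma$ is injective. 4. *Localization and orthogonality.* Let $d\ge1$. Every string $P$ with $\chi(P,L_\sigma)\neq0$ has $\Gamma_P=\Gamma_\sigma$; and if $d\ge2$ or $\sigma=e$, then $L_\sigma\ne0$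 and $\Gamma_{L_\sigma}=\Gamma_\sigma$. If $\Gamma_\sigma\neq\Gamma_\pi$ then $\chi(L_\sigma,L_\pi)=0$, so that the Gram matrix $\big(\chi(L_\sigma,L_\pi)\big)_{\sigma,\pi\in S_t}$ is the direct sum, over $\Gamma\subseteq[t]$, of its blocks on $\{\sigma:\Gamma_\sigma=\Gamma\}$. Moreover, for all $\sigma,\pi\in S_t$, $$|\chi(L_\sigma,L_\pi)|\le c(\sigma)^2\,c(\pi)^2\,d^{|\sigma|+|\pi|}\,\delta_{\Gamma_\sigma\Gamma_\pi}.$$ -/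

import Mathlib

open scoped Matrix

noncomputable section

namespace LocalizedPerm

/-! ### Combinatorics of permutations of `[t] = {0, …, t-1}` -/

/-- The size `|σ|`: the least number of transpositions whose product is `σ`. -/
def permSize {t : ℕ} (σ : Equiv.Perm (Fin t)) : ℕ :=
  sInf {n : ℕ | ∃ l : List (Equiv.Perm (Fin t)), (∀ τ ∈ l, τ.IsSwap) ∧ l.prod = σ ∧ l.length = n}

/-- `π ⊆ σ`, that is `|π⁻¹ σ| = |σ| - |π|`, written without subtraction. -/
def SubPerm {t : ℕ} (π σ : Equiv.Perm (Fin t)) : Prop :=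
  permSize π + permSize (π⁻¹ * σ) = permSize σ

instance {t : ℕ} (π σ : Equiv.Perm (Fin t)) : Decidable (SubPerm π σ) :=
  inferInstanceAs (Decidable (_ = _))

/-- The finite set of sub-permutations of `σ`. -/
def subPerms {t : ℕ} (σ : Equiv.Perm (Fin t)) : Finset (Equiv.Perm (Fin t)) :=
  Finset.univ.filter fun π => SubPerm π σ

/-- The product, over the nontrivial cycles `λ` of `σ`, of the Catalan numbers `c_{l_λ}`, with
`l_λ` the length of `λ`. -/
def catalanProd {t : ℕ} (σ : Equiv.Perm (Fin t)) : ℕ :=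
  ∏ c ∈ σ.cycleFactorsFinset, catalan c.support.card

/-- The product, over the nontrivial cycles `λ` of `σ`, of `(-1)^{|λ|} c_{|λ|}`. -/
def mobius {t : ℕ} (σ : Equiv.Perm (Fin t)) : ℤ :=
  ∏ c ∈ σ.cycleFactorsFinset, (-1) ^ permSize c * (catalan (permSize c) : ℤ)

/-- The change of basis matrix `φ_t(σ, π)`. -/
def phi (t : ℕ) : Matrix (Equiv.Perm (Fin t)) (Equiv.Perm (Fin t)) ℤ :=
  Matrix.of fun σ π => if SubPerm π σ then mobius (π⁻¹ * σ) else 0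

/-- The zeta matrix `δ_{σ ⊇ π}`. -/
def zeta (t : ℕ) : Matrix (Equiv.Perm (Fin t)) (Equiv.Perm (Fin t)) ℤ :=
  Matrix.of fun σ π => if SubPerm π σ then 1 else 0

/-! ### Operators -/

/-- Operators on `ℂ^d`. -/
abbrev Op (d : ℕ) : Type := Matrix (Fin d) (Fin d) ℂ

/-- Operators on `(ℂ^d)^{⊗ t}`, as matrices in the product basis. -/
abbrev TOp (t d : ℕ) : Type := Matrix (Fin t → Fin d) (Fin t → Fin d) ℂ

/-- The normalized inner product `Tr[X† Y] / dim`; the dimension is `d` on `ℂ^d` and `d ^ t` on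
`(ℂ^d)^{⊗ t}`. -/
def overlap {n : Type} [Fintype n] (X Y : Matrix n n ℂ) : ℂ :=
  (Xᴴ * Y).trace / (Fintype.card n : ℂ)

/-- The representation permuting tensor factors: `R_σ |y⟩ = |y ∘ σ⁻¹⟩`. -/
def permOp {t : ℕ} (d : ℕ) (σ : Equiv.Perm (Fin t)) : TOp t d :=
  Matrix.of fun x y => if x = y ∘ ⇑σ⁻¹ then 1 else 0

/-- The character-normalized permutation `R_σ / χ(σ)`, `χ(σ)` being the normalized trace. -/
def normPerm {t : ℕ} (d : ℕ) (σ : Equiv.Perm (Fin t)) : TOp t d :=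
  (overlap (1 : TOp t d) (permOp d σ))⁻¹ • permOp d σ

/-- The localized permutation `∑_{π ⊆ σ} φ_t(σ, π) N_π`, with `N_π` the normalized permutation. -/
def locPerm {t : ℕ} (d : ℕ) (σ : Equiv.Perm (Fin t)) : TOp t d :=
  ∑ π ∈ subPerms σ, (phi t σ π : ℂ) • normPerm d π

/-- The Gram matrix of the localized permutations. -/
def locGram (t d : ℕ) : Matrix (Equiv.Perm (Fin t)) (Equiv.Perm (Fin t)) ℂ :=
  Matrix.of fun σ π => overlap (locPerm d σ) (locPerm d π)

/-- The diagonal block of the Gram matrix on the permutations with support `Γ`. -/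
def locGramBlock (t d : ℕ) (Γ : Finset (Fin t)) :
    Matrix {σ : Equiv.Perm (Fin t) // σ.support = Γ} {σ : Equiv.Perm (Fin t) // σ.support = Γ} ℂ :=
  (locGram t d).submatrix Subtype.val Subtype.val

/-! ### Operator strings and supports -/

/-- An orthonormal basis (for the normalized inner product) of the operators on `ℂ^d` that
contains the identity. -/
structure IsOperatorBasis {d : ℕ} (B : Finset (Op d)) : Prop where
  one_mem : (1 : Op d) ∈ B
  overlap_self : ∀ P ∈ B, overlap P P = 1
  overlap_ne : ∀ P ∈ B, ∀ S ∈ B, P ≠ S → overlap P S = 0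
  span_eq_top : Submodule.span ℂ (B : Set (Op d)) = ⊤

/-- The tensor product `P_0 ⊗ ⋯ ⊗ P_{t-1}`. -/
def tensorOp {t d : ℕ} (P : Fin t → Op d) : TOp t d :=
  Matrix.of fun x y => ∏ i, P i (x i) (y i)

/-- The support of a string of operators: the copies that carry a non-identity operator. -/
def stringSupport {t d : ℕ} (P : Fin t → Op d) : Finset (Fin t) :=
  Finset.univ.filter fun i => P i ≠ 1

/-- The support of a general operator: the union of the supports of the basis strings that occur
in its expansion with nonzero coefficient. -/
def opSupport {t d : ℕ} (B : Finset (Op d)) (X : TOp t d) : Set (Fin t) :=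
  {i | ∃ P : Fin t → Op d, (∀ j, P j ∈ B) ∧ overlap (tensorOp P) X ≠ 0 ∧ i ∈ stringSupport P}

end LocalizedPerm

end

open scoped Matrix

noncomputable section

namespace LocalizedPerm

open Equiv Equiv.Perm

variable {t d : ℕ}

/-! ### The size of a permutation -/

/-! The functions on `[t]` constant along the cycles of `σ` form a space of dimension `t - |σ|`
(`permSize_add_finrank`). Hence a transposition lowers the size by one when it cuts a cycle and
raises it by one when it joins two. It follows that sub-permutations refine cycles and factor over
disjoint products, so that most questions about the order reduce to a single cycle, written as a
list.

A transposition `swap i j` cuts such a cycle into two arcs, and summing over `j` produces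
convolutions. The Catalan recursion thus counts sub-permutations (`card_subPerms_formPerm`), and its
signed form governs `mobius` (`sum_mobius_swap_mul`). Consequently the polynomial `∑ μ(κ) x^|κ|`
over `κ ⊆ σ` satisfies a recursion (`charSum_eq`). At `x = 1` it vanishes on every nontrivial cycle;
since the interval from `π` to `σ` corresponds to the sub-permutations of `π⁻¹σ` (`interval_iff`),
this is Möbius inversion.

Localization rests on the uniqueness of that inversion (`map_locPerm_eq_zero`). A functional acting
trivially on copy `i` cannot tell `N_π` from `N` of `π` with `i` deleted, and must therefore kill
every `L_σ` that moves `i`. Conversely, a traceless factor on a copy fixed by `σ` kills each term of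
`L_σ`. Together these give definite support; the first also gives orthogonality between supports.
The bound on overlaps is termwise.

For nonvanishing, the polynomial at `x = 1/d` is, up to a power of `d`, a matrix entry of `L_σ` at a
constant coloring. It can vanish on a cycle; giving one point of that cycle a second color replaces
its factor by that of a cycle one shorter, and a three-term recurrence forbids two consecutive zeros
(`cycleSum_ne_zero_or`). -/

lemma exists_swap_list (σ : Perm (Fin t)) :
    ∃ l : List (Perm (Fin t)), (∀ τ ∈ l, τ.IsSwap) ∧ l.prod = σ ∧ l.length = permSize σ := by
  have h : {n : ℕ | ∃ l : List (Perm (Fin t)), (∀ τ ∈ l, τ.IsSwap) ∧ l.prod = σ ∧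
      l.length = n}.Nonempty := by
    obtain ⟨l, hl⟩ := (Perm.truncSwapFactors σ).exists_rep
    exact ⟨_, l.1, l.2.2, l.2.1, rfl⟩
  exact Nat.sInf_mem h

lemma permSize_le_length (l : List (Perm (Fin t))) (hl : ∀ τ ∈ l, τ.IsSwap) :
    permSize l.prod ≤ l.length :=
  Nat.sInf_le ⟨l, hl, rfl, rfl⟩

@[simp] lemma permSize_one : permSize (1 : Perm (Fin t)) = 0 := by
  have := permSize_le_length (t := t) [] (by simp)
  simpa using this

lemma permSize_mul_le (σ τ : Perm (Fin t)) : permSize (σ * τ) ≤ permSize σ + permSize τ := by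
  obtain ⟨l, hl, hlσ, hll⟩ := exists_swap_list σ
  obtain ⟨m, hm, hmτ, hml⟩ := exists_swap_list τ
  have := permSize_le_length (l ++ m) (by
    intro τ hτ
    rcases List.mem_append.1 hτ with h | h
    exacts [hl _ h, hm _ h])
  simpa [hlσ, hmτ, hll, hml] using this

lemma permSize_swap_le (a b : Fin t) : permSize (swap a b) ≤ 1 := by
  by_cases h : a = b
  · subst h
    have h1 : swap a a = (1 : Perm (Fin t)) := swap_self a
    rw [h1, permSize_one]
    exact zero_le_one
  · have := permSize_le_length [swap a b] (by simpa using ⟨a, b, h, rfl⟩)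
    simpa using this

lemma permSize_inv_le (σ : Perm (Fin t)) : permSize σ⁻¹ ≤ permSize σ := by
  obtain ⟨l, hl, hlσ, hll⟩ := exists_swap_list σ
  have h1 : (l.map fun τ => τ⁻¹).reverse.prod = σ⁻¹ := by
    rw [← hlσ, List.prod_inv_reverse]
  rw [← h1, ← hll]
  refine (permSize_le_length _ ?_).trans (by simp)
  intro τ hτ
  simp only [List.mem_reverse, List.mem_map] at hτ
  obtain ⟨ρ, hρ, rfl⟩ := hτ
  obtain ⟨a, b, hab, h⟩ := hl ρ hρ
  exact ⟨a, b, hab, by rw [h, swap_inv]⟩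

@[simp] lemma permSize_inv (σ : Perm (Fin t)) : permSize σ⁻¹ = permSize σ :=
  le_antisymm (permSize_inv_le σ) (by simpa using permSize_inv_le σ⁻¹)

lemma permSize_conj_le (ρ σ : Perm (Fin t)) : permSize (ρ * σ * ρ⁻¹) ≤ permSize σ := by
  obtain ⟨l, hl, hlσ, hll⟩ := exists_swap_list σ
  have h1 : (l.map (MulAut.conj ρ)).prod = ρ * σ * ρ⁻¹ := by
    rw [← map_list_prod, hlσ, MulAut.conj_apply]
  rw [← h1, ← hll]
  refine (permSize_le_length _ ?_).trans (by simp)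
  intro τ hτ
  simp only [List.mem_map] at hτ
  obtain ⟨κ, hκ, rfl⟩ := hτ
  obtain ⟨a, b, hab, h⟩ := hl κ hκ
  exact ⟨ρ a, ρ b, by simpa using hab, by
    rw [h, MulAut.conj_apply, Equiv.mul_swap_eq_swap_mul]; simp⟩

@[simp] lemma permSize_conj (ρ σ : Perm (Fin t)) : permSize (ρ * σ * ρ⁻¹) = permSize σ := by
  refine le_antisymm (permSize_conj_le ρ σ) ?_
  have := permSize_conj_le ρ⁻¹ (ρ * σ * ρ⁻¹)
  simpa [mul_assoc] using this

lemma permSize_mul_comm (σ τ : Perm (Fin t)) : permSize (σ * τ) = permSize (τ * σ) := by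
  have := permSize_conj σ (τ * σ)
  simpa [mul_assoc] using this

lemma sign_eq_permSize (σ : Perm (Fin t)) : sign σ = (-1) ^ permSize σ := by
  obtain ⟨l, hl, hlσ, hll⟩ := exists_swap_list σ
  rw [← hll, ← sign_prod_list_swap hl, hlσ]

lemma permSize_swap_mul_ne {a b : Fin t} (h : a ≠ b) (σ : Perm (Fin t)) :
    permSize (swap a b * σ) ≠ permSize σ := by
  intro h1
  have h2 := sign_eq_permSize (swap a b * σ)
  rw [h1, ← sign_eq_permSize, Perm.sign_mul, sign_swap h] at h2
  rcases Int.units_eq_one_or (sign σ) with h3 | h3 <;> rw [h3] at h2 <;> revert h2 <;> decide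

/-- The functions on `[t]` that are constant along the cycles of `σ`. -/
def fixedFunctions (σ : Perm (Fin t)) : Submodule ℚ (Fin t → ℚ) where
  carrier := {f | ∀ x, f (σ x) = f x}
  add_mem' hf hg x := by simp [hf x, hg x]
  zero_mem' x := rfl
  smul_mem' c f hf x := by simp [hf x]

lemma mem_fixedFunctions {σ : Perm (Fin t)} {f : Fin t → ℚ} :
    f ∈ fixedFunctions σ ↔ ∀ x, f (σ x) = f x := Iff.rfl

lemma apply_eq_of_sameCycle {σ : Perm (Fin t)} {f : Fin t → ℚ} (hf : f ∈ fixedFunctions σ)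
    {x y : Fin t} (h : σ.SameCycle x y) : f x = f y := by
  obtain ⟨n, -, -, rfl⟩ := h.exists_pow_eq
  clear h
  induction n with
  | zero => simp
  | succ n ih => rw [pow_succ', Perm.mul_apply, hf, ih]

lemma indicator_mem_fixedFunctions (σ : Perm (Fin t)) (x : Fin t) :
    (fun y => if σ.SameCycle x y then (1 : ℚ) else 0) ∈ fixedFunctions σ := by
  intro y
  simp

lemma fixedFunctions_inf_le (π κ : Perm (Fin t)) :
    fixedFunctions π ⊓ fixedFunctions κ ≤ fixedFunctions (π * κ) := by
  rintro f ⟨h1, h2⟩ x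
  rw [Perm.mul_apply, h1, h2]

lemma finrank_add_finrank_le (U V : Submodule ℚ (Fin t → ℚ)) :
    Module.finrank ℚ U + Module.finrank ℚ V ≤ t + Module.finrank ℚ ↥(U ⊓ V) := by
  have h1 := Submodule.finrank_sup_add_finrank_inf_eq U V
  have h2 := Submodule.finrank_le (U ⊔ V)
  simp only [Module.finrank_fintype_fun_eq_card, Fintype.card_fin] at h2
  omega

/-- The functions that agree at two points. -/
def agreeing (a b : Fin t) : Submodule ℚ (Fin t → ℚ) :=
  LinearMap.ker (LinearMap.proj (R := ℚ) (φ := fun _ : Fin t => ℚ) a - LinearMap.proj b)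

lemma mem_agreeing {a b : Fin t} {f : Fin t → ℚ} : f ∈ agreeing a b ↔ f a = f b := by
  simp [agreeing, sub_eq_zero]

lemma le_finrank_agreeing (a b : Fin t) : t ≤ Module.finrank ℚ (agreeing a b) + 1 := by
  have h1 := LinearMap.finrank_range_add_finrank_ker
    (LinearMap.proj (R := ℚ) (φ := fun _ : Fin t => ℚ) a - LinearMap.proj b)
  have h2 := Submodule.finrank_le (LinearMap.range
    (LinearMap.proj (R := ℚ) (φ := fun _ : Fin t => ℚ) a - LinearMap.proj b))
  simp only [Module.finrank_fintype_fun_eq_card, Fintype.card_fin, Module.finrank_self] at h1 h2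
  unfold agreeing
  omega

lemma fixedFunctions_inf_agreeing_le (σ : Perm (Fin t)) (a b : Fin t) :
    fixedFunctions σ ⊓ agreeing a b ≤ fixedFunctions (swap a b * σ) := by
  rintro f ⟨h1, h2⟩
  have h2 := mem_agreeing.1 h2
  intro x
  rw [Perm.mul_apply, ← h1 x]
  generalize σ x = y
  rw [swap_apply_def]
  split_ifs with h3 h4 <;> simp_all

lemma finrank_fixedFunctions_swap_mul (σ : Perm (Fin t)) (a b : Fin t) :
    Module.finrank ℚ (fixedFunctions σ) ≤ Module.finrank ℚ (fixedFunctions (swap a b * σ)) + 1 := by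
  have h1 := finrank_add_finrank_le (fixedFunctions σ) (agreeing a b)
  have h2 := le_finrank_agreeing a b
  have h3 := Submodule.finrank_mono (fixedFunctions_inf_agreeing_le σ a b)
  omega

lemma finrank_fixedFunctions_one : Module.finrank ℚ (fixedFunctions (1 : Perm (Fin t))) = t := by
  have : fixedFunctions (1 : Perm (Fin t)) = ⊤ := by
    ext f; simp [mem_fixedFunctions]
  rw [this, finrank_top]; simp

/-- The identity fixes a space of dimension `t`, and each transposition imposes at most one more
linear condition. -/
lemma le_permSize_add_finrank (σ : Perm (Fin t)) :
    t ≤ permSize σ + Module.finrank ℚ (fixedFunctions σ) := by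
  obtain ⟨l, hl, rfl, hll⟩ := exists_swap_list σ
  rw [← hll]
  clear hll
  induction l with
  | nil =>
    change t ≤ 0 + Module.finrank ℚ (fixedFunctions (1 : Perm (Fin t)))
    rw [finrank_fixedFunctions_one, zero_add]
  | cons τ l ih =>
    obtain ⟨a, b, -, rfl⟩ := hl τ (by simp)
    have h1 := ih fun τ h => hl τ (by simp [h])
    have h2 := finrank_fixedFunctions_swap_mul l.prod a b
    change t ≤ l.length + 1 + Module.finrank ℚ (fixedFunctions (swap a b * l.prod))
    omega

lemma permSize_add_finrank_le (σ : Perm (Fin t)) :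
    permSize σ + Module.finrank ℚ (fixedFunctions σ) ≤ t := by
  obtain ⟨n, hn⟩ : ∃ n, σ.support.card = n := ⟨_, rfl⟩
  induction n using Nat.strong_induction_on generalizing σ with
  | _ n ih =>
    by_cases h1 : σ = 1
    · subst h1; simp [finrank_fixedFunctions_one]
    obtain ⟨a, ha⟩ : ∃ a, σ a ≠ a := by
      by_contra! h; exact h1 (Equiv.ext h)
    -- Splitting `a` off as a fixed point costs one transposition and must enlarge the fixed space.
    set ρ := swap a (σ a) * σ with hρ
    have hσ : σ = swap a (σ a) * ρ := by simp [hρ, ← mul_assoc]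
    have hρa : ρ a = a := by simp [hρ]
    have hcard : ρ.support.card < n := by
      rw [← hn]
      exact card_support_swap_mul ha
    have h2 := ih _ hcard ρ rfl
    have h3 : permSize σ ≤ permSize ρ + 1 := by
      have h := permSize_mul_le (swap a (σ a)) ρ
      have := permSize_swap_le a (σ a)
      rw [← hσ] at h
      omega
    have h4 : fixedFunctions σ < fixedFunctions ρ := by
      refine lt_of_le_of_ne ?_ ?_
      · refine le_trans (le_inf le_rfl ?_) (fixedFunctions_inf_agreeing_le σ a (σ a))
        intro f hf
        exact mem_agreeing.2 (hf a).symm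
      · intro h
        -- The `ρ`-cycle of `a` is `{a}`; its indicator is fixed by `ρ` but not by `σ`.
        have h5 := indicator_mem_fixedFunctions ρ a
        rw [← h] at h5
        have h6 := h5 a
        have h7 : ¬ ρ.SameCycle a (σ a) := by
          intro h
          obtain ⟨k, hk⟩ := h
          rw [zpow_apply_eq_self_of_apply_eq_self hρa] at hk
          exact ha hk.symm
        simp [h7, SameCycle.refl] at h6
    have h5 := Submodule.finrank_lt_finrank_of_lt h4
    omega

lemma permSize_add_finrank (σ : Perm (Fin t)) :
    permSize σ + Module.finrank ℚ (fixedFunctions σ) = t :=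
  le_antisymm (permSize_add_finrank_le σ) (le_permSize_add_finrank σ)

lemma permSize_eq_zero_iff {σ : Perm (Fin t)} : permSize σ = 0 ↔ σ = 1 := by
  refine ⟨fun h => ?_, fun h => by simp [h]⟩
  obtain ⟨l, -, rfl, hll⟩ := exists_swap_list σ
  rw [h, List.length_eq_zero_iff] at hll
  simp [hll]

/-- Functions fixed by `σ` already agree at `a` and `b`, so the fixed space does not shrink and the
size does not grow. Parity excludes equality, and the triangle inequality limits the drop to one. -/
lemma permSize_swap_mul_of_sameCycle {σ : Perm (Fin t)} {a b : Fin t} (hab : a ≠ b)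
    (h : σ.SameCycle a b) : permSize (swap a b * σ) + 1 = permSize σ := by
  have h1 : fixedFunctions σ ≤ fixedFunctions (swap a b * σ) :=
    le_trans (le_inf le_rfl fun f hf => mem_agreeing.2 (apply_eq_of_sameCycle hf h))
      (fixedFunctions_inf_agreeing_le σ a b)
  have h2 := Submodule.finrank_mono h1
  have h3 := permSize_add_finrank σ
  have h4 := permSize_add_finrank (swap a b * σ)
  have h5 := permSize_swap_mul_ne hab σ
  have h6 := permSize_mul_le (swap a b) (swap a b * σ)
  have h7 := permSize_swap_le a b
  rw [← mul_assoc, swap_mul_self, one_mul] at h6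
  omega

/-- Otherwise the size drops and the fixed space of `swap a b * σ` gains a dimension. Its part
agreeing at `a` and `b` would then be all of `fixedFunctions σ`, yet the indicator of the cycle of
`a` separates the two points. -/
lemma permSize_swap_mul_of_not_sameCycle {σ : Perm (Fin t)} {a b : Fin t}
    (h : ¬ σ.SameCycle a b) : permSize (swap a b * σ) = permSize σ + 1 := by
  have hab : a ≠ b := by rintro rfl; exact h (SameCycle.refl _ _)
  have h5 := permSize_swap_mul_ne hab σ
  have h6 := permSize_mul_le (swap a b) σ
  have h7 := permSize_swap_le a b
  by_contra hne
  have h3 := permSize_add_finrank σ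
  have h4 := permSize_add_finrank (swap a b * σ)
  have h8 := fixedFunctions_inf_agreeing_le (swap a b * σ) a b
  rw [← mul_assoc, swap_mul_self, one_mul] at h8
  have h9 := finrank_add_finrank_le (fixedFunctions (swap a b * σ)) (agreeing a b)
  have h10 := le_finrank_agreeing a b
  have h11 := Submodule.eq_of_le_of_finrank_le h8 (by omega)
  have h12 := indicator_mem_fixedFunctions σ a
  rw [← h11] at h12
  have h13 := mem_agreeing.1 h12.2
  simp [h, SameCycle.refl] at h13

/-! ### The order of sub-permutations -/

lemma mem_subPerms {π σ : Perm (Fin t)} : π ∈ subPerms σ ↔ SubPerm π σ := by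
  simp [subPerms]

lemma SubPerm.refl (σ : Perm (Fin t)) : SubPerm σ σ := by simp [SubPerm]

lemma SubPerm.of_le {π σ : Perm (Fin t)} (h : permSize π + permSize (π⁻¹ * σ) ≤ permSize σ) :
    SubPerm π σ := by
  have := permSize_mul_le π (π⁻¹ * σ)
  rw [mul_inv_cancel_left] at this
  exact le_antisymm h this

lemma permSize_inv_mul_le (π ρ σ : Perm (Fin t)) :
    permSize (π⁻¹ * σ) ≤ permSize (π⁻¹ * ρ) + permSize (ρ⁻¹ * σ) := by
  simpa [mul_assoc] using permSize_mul_le (π⁻¹ * ρ) (ρ⁻¹ * σ)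

lemma SubPerm.trans {π ρ σ : Perm (Fin t)} (h1 : SubPerm π ρ) (h2 : SubPerm ρ σ) :
    SubPerm π σ := by
  apply SubPerm.of_le
  have h3 := permSize_inv_mul_le π ρ σ
  unfold SubPerm at h1 h2
  omega

lemma SubPerm.permSize_le {π σ : Perm (Fin t)} (h : SubPerm π σ) : permSize π ≤ permSize σ :=
  Nat.le.intro h

lemma SubPerm.eq_of_permSize_le {π σ : Perm (Fin t)} (h : SubPerm π σ)
    (h' : permSize σ ≤ permSize π) : π = σ := by
  have h1 : permSize (π⁻¹ * σ) = 0 := by unfold SubPerm at h; omega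
  exact inv_mul_eq_one.1 (permSize_eq_zero_iff.1 h1)

lemma isPartialOrder_subPerm : IsPartialOrder (Perm (Fin t)) SubPerm where
  refl := SubPerm.refl
  trans _ _ _ := SubPerm.trans
  antisymm _ _ h1 h2 := h1.eq_of_permSize_le h2.permSize_le

lemma subPerm_one_right {π : Perm (Fin t)} : SubPerm π 1 ↔ π = 1 := by
  refine ⟨fun h => h.eq_of_permSize_le (by simp), fun h => by simp [h, SubPerm.refl]⟩

/-- Passing to the complement `π⁻¹ σ`. -/
lemma subPerm_inv_mul_iff {π σ : Perm (Fin t)} : SubPerm (π⁻¹ * σ) σ ↔ SubPerm π σ := by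
  unfold SubPerm
  have h : permSize ((π⁻¹ * σ)⁻¹ * σ) = permSize π := by
    have := permSize_conj σ⁻¹ π
    simpa [mul_assoc] using this
  rw [h, add_comm]

/-- By the triangle inequality both sides say `|π| + |π⁻¹ρ| + |ρ⁻¹σ| = |σ|`. This makes the Möbius
function of an interval depend on `π⁻¹σ` alone. -/
lemma interval_iff {π ρ σ : Perm (Fin t)} :
    (SubPerm π ρ ∧ SubPerm ρ σ) ↔ (SubPerm π σ ∧ SubPerm (ρ⁻¹ * σ) (π⁻¹ * σ)) := by
  have h : permSize ((ρ⁻¹ * σ)⁻¹ * (π⁻¹ * σ)) = permSize (π⁻¹ * ρ) := by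
    have h1 := permSize_conj σ⁻¹ (ρ * π⁻¹)
    rw [permSize_mul_comm ρ] at h1
    rw [← h1]; simp [mul_assoc]
  have h1 := permSize_inv_mul_le π ρ σ
  have h2 := permSize_mul_le π (π⁻¹ * ρ)
  have h3 := permSize_mul_le ρ (ρ⁻¹ * σ)
  have h4 := permSize_mul_le π (π⁻¹ * σ)
  rw [mul_inv_cancel_left] at h2 h3 h4
  unfold SubPerm
  rw [h]
  omega

/-- Sizes are codimensions, so the functions fixed by both `π` and `π⁻¹σ` have codimension at most
`|σ|`. Being contained in the fixed space of `σ`, they exhaust it. -/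
lemma SubPerm.fixedFunctions_le {π σ : Perm (Fin t)} (h : SubPerm π σ) :
    fixedFunctions σ ≤ fixedFunctions π := by
  have h1 := fixedFunctions_inf_le π (π⁻¹ * σ)
  rw [mul_inv_cancel_left] at h1
  have h2 := finrank_add_finrank_le (fixedFunctions π) (fixedFunctions (π⁻¹ * σ))
  have h3 := permSize_add_finrank π
  have h4 := permSize_add_finrank (π⁻¹ * σ)
  have h5 := permSize_add_finrank σ
  unfold SubPerm at h
  rw [← Submodule.eq_of_le_of_finrank_le h1 (by omega)]
  exact inf_le_left

lemma SubPerm.sameCycle {π σ : Perm (Fin t)} (h : SubPerm π σ) {x y : Fin t}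
    (hxy : π.SameCycle x y) : σ.SameCycle x y := by
  have h1 := apply_eq_of_sameCycle (h.fixedFunctions_le (indicator_mem_fixedFunctions σ x)) hxy
  by_contra h2
  simp [h2, SameCycle.refl] at h1

lemma SubPerm.sameCycle_apply {π σ : Perm (Fin t)} (h : SubPerm π σ) (x : Fin t) :
    σ.SameCycle x (π x) :=
  h.sameCycle (sameCycle_apply_right.2 (SameCycle.refl _ _))

lemma eq_of_sameCycle_of_apply_eq {σ : Perm (Fin t)} {x y : Fin t} (hx : σ x = x)
    (h : σ.SameCycle x y) : y = x := by
  obtain ⟨k, hk⟩ := h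
  rw [zpow_apply_eq_self_of_apply_eq_self hx] at hk
  exact hk.symm

lemma SubPerm.apply_eq {π σ : Perm (Fin t)} (h : SubPerm π σ) {x : Fin t} (hx : σ x = x) :
    π x = x :=
  eq_of_sameCycle_of_apply_eq hx (h.sameCycle_apply x)

lemma subPerm_swap_mul_iff {κ σ : Perm (Fin t)} {a b : Fin t} (hab : a ≠ b)
    (hκ : κ.SameCycle a b) (hσ : σ.SameCycle a b) :
    SubPerm (swap a b * κ) (swap a b * σ) ↔ SubPerm κ σ := by
  have h1 := permSize_swap_mul_of_sameCycle hab hκ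
  have h2 := permSize_swap_mul_of_sameCycle hab hσ
  have h3 : (swap a b * κ)⁻¹ * (swap a b * σ) = κ⁻¹ * σ := by simp [mul_assoc]
  unfold SubPerm
  rw [h3]
  omega

/-- A sub-permutation of a permutation that separates two points. -/
lemma subPerm_of_swap_mul {ρ σ : Perm (Fin t)} {a b : Fin t} (hab : a ≠ b)
    (hσ : σ.SameCycle a b) (hρ : ¬ ρ.SameCycle a b) :
    SubPerm ρ (swap a b * σ) ↔ SubPerm (swap a b * ρ) σ := by
  have h1 := permSize_swap_mul_of_not_sameCycle hρ
  have h2 := permSize_swap_mul_of_sameCycle hab hσ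
  have h3 : (swap a b * ρ)⁻¹ * σ = ρ⁻¹ * (swap a b * σ) := by simp [mul_assoc]
  unfold SubPerm
  rw [h3]
  omega

lemma not_sameCycle_swap_mul {σ : Perm (Fin t)} {a b : Fin t} (hab : a ≠ b)
    (hσ : σ.SameCycle a b) : ¬ (swap a b * σ).SameCycle a b := by
  intro h
  have h1 := permSize_swap_mul_of_sameCycle hab h
  have h2 := permSize_swap_mul_of_sameCycle hab hσ
  rw [← mul_assoc, swap_mul_self, one_mul] at h1
  omega

lemma sameCycle_swap_mul {σ : Perm (Fin t)} {a b : Fin t}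
    (hσ : ¬ σ.SameCycle a b) : (swap a b * σ).SameCycle a b := by
  by_contra h
  have h1 := permSize_swap_mul_of_not_sameCycle h
  have h2 := permSize_swap_mul_of_not_sameCycle hσ
  rw [← mul_assoc, swap_mul_self, one_mul] at h1
  omega

/-! ### Deleting a point -/

/-- The permutation `σ` with the point `i` removed from its cycle. -/
def deletePoint (σ : Perm (Fin t)) (i : Fin t) : Perm (Fin t) := swap i (σ i) * σ

@[simp] lemma deletePoint_apply_self (σ : Perm (Fin t)) (i : Fin t) :
    deletePoint σ i i = i := by simp [deletePoint]

lemma deletePoint_of_apply_eq {σ : Perm (Fin t)} {i : Fin t} (h : σ i = i) :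
    deletePoint σ i = σ := by
  have h1 : swap i i = (1 : Perm (Fin t)) := swap_self i
  rw [deletePoint, h, h1, one_mul]

lemma permSize_deletePoint {σ : Perm (Fin t)} {i : Fin t} (h : σ i ≠ i) :
    permSize (deletePoint σ i) + 1 = permSize σ :=
  permSize_swap_mul_of_sameCycle h.symm (sameCycle_apply_right.2 (SameCycle.refl _ _))

/-- When `π` fixes `i`, deleting `i` commutes with left multiplication by `π⁻¹`, so `|σ|` and
`|π⁻¹σ|` drop by one together. -/
lemma subPerm_deletePoint_iff {π σ : Perm (Fin t)} {i : Fin t} :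
    SubPerm π (deletePoint σ i) ↔ SubPerm π σ ∧ π i = i := by
  by_cases h : σ i = i
  · rw [deletePoint_of_apply_eq h]
    exact ⟨fun h' => ⟨h', h'.apply_eq h⟩, fun h' => h'.1⟩
  have key : π i = i → permSize (π⁻¹ * deletePoint σ i) + 1 = permSize (π⁻¹ * σ) := by
    intro hπ
    have hπ' : π⁻¹ i = i := by rw [Perm.inv_eq_iff_eq, hπ]
    have h1 : (π⁻¹ * σ) i ≠ i := by
      rw [Perm.mul_apply, Ne, Perm.inv_eq_iff_eq, hπ]; exact h
    rw [← permSize_deletePoint h1]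
    congr 2
    unfold deletePoint
    rw [← mul_assoc, Equiv.mul_swap_eq_swap_mul, hπ', mul_assoc, Perm.mul_apply]
  have h2 := permSize_deletePoint h
  constructor
  · intro h'
    have hπ : π i = i := h'.apply_eq (by simp)
    have := key hπ
    refine ⟨?_, hπ⟩
    unfold SubPerm at h' ⊢
    omega
  · rintro ⟨h', hπ⟩
    have := key hπ
    unfold SubPerm at h' ⊢
    omega

/-! ### Disjoint products -/

lemma permSize_mul_of_disjoint {σ τ : Perm (Fin t)} (h : σ.Disjoint τ) :
    permSize (σ * τ) = permSize σ + permSize τ := by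
  obtain ⟨n, hn⟩ : ∃ n, permSize σ = n := ⟨_, rfl⟩
  induction n generalizing σ with
  | zero => rw [permSize_eq_zero_iff.1 hn]; simp
  | succ n ih =>
    obtain ⟨a, ha⟩ : ∃ a, σ a ≠ a := by
      by_contra! h'
      rw [show σ = 1 from Equiv.ext h', permSize_one] at hn
      omega
    have hτ : τ a = a := (h a).resolve_left ha
    have hd : (deletePoint σ a).Disjoint τ := by
      intro x
      rcases h x with hx | hx
      · left
        have h1 : x ≠ a := by rintro rfl; exact ha hx
        have h2 : x ≠ σ a := by
          rintro rfl
          exact ha (σ.injective hx)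
        rw [deletePoint, Perm.mul_apply, hx, swap_apply_of_ne_of_ne h1 h2]
      · exact Or.inr hx
    have h1 := permSize_deletePoint ha
    have h2 := ih hd (by omega)
    have h3 : (σ * τ) a = σ a := by simp [hτ]
    have h4 := permSize_deletePoint (σ := σ * τ) (i := a) (by rwa [h3])
    have h5 : deletePoint (σ * τ) a = deletePoint σ a * τ := by
      rw [deletePoint, deletePoint, h3, mul_assoc]
    rw [h5] at h4
    omega

lemma subPerm_mul_iff {σ₁ σ₂ κ₁ κ₂ : Perm (Fin t)} (hσ : σ₁.Disjoint σ₂) (h₁ : κ₁.Disjoint σ₂)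
    (h₂ : σ₁.Disjoint κ₂) (hκ : κ₁.Disjoint κ₂) :
    SubPerm (κ₁ * κ₂) (σ₁ * σ₂) ↔ SubPerm κ₁ σ₁ ∧ SubPerm κ₂ σ₂ := by
  have h3 : (κ₁ * κ₂)⁻¹ * (σ₁ * σ₂) = (κ₁⁻¹ * σ₁) * (κ₂⁻¹ * σ₂) := by
    have hc : κ₂⁻¹ * (κ₁⁻¹ * σ₁) = κ₁⁻¹ * σ₁ * κ₂⁻¹ :=
      ((hκ.symm.inv_left.inv_right.commute).mul_right (h₂.symm.inv_left.commute)).eq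
    rw [mul_inv_rev, mul_assoc, ← mul_assoc κ₁⁻¹, ← mul_assoc κ₂⁻¹, hc, mul_assoc]
  have h4 : (κ₁⁻¹ * σ₁).Disjoint (κ₂⁻¹ * σ₂) :=
    Disjoint.mul_left (Disjoint.mul_right hκ.inv_left.inv_right h₁.inv_left)
      (Disjoint.mul_right h₂.inv_right hσ)
  have h5 := permSize_mul_le κ₁ (κ₁⁻¹ * σ₁)
  have h6 := permSize_mul_le κ₂ (κ₂⁻¹ * σ₂)
  rw [mul_inv_cancel_left] at h5 h6
  unfold SubPerm
  rw [h3, permSize_mul_of_disjoint h4, permSize_mul_of_disjoint hσ, permSize_mul_of_disjoint hκ]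
  omega

lemma SubPerm.disjoint {κ₁ κ₂ σ₁ σ₂ : Perm (Fin t)} (hσ : σ₁.Disjoint σ₂) (h₁ : SubPerm κ₁ σ₁)
    (h₂ : SubPerm κ₂ σ₂) : κ₁.Disjoint κ₂ := by
  intro x
  rcases hσ x with h | h
  exacts [Or.inl (h₁.apply_eq h), Or.inr (h₂.apply_eq h)]

lemma SubPerm.mul {κ₁ κ₂ σ₁ σ₂ : Perm (Fin t)} (hσ : σ₁.Disjoint σ₂) (h₁ : SubPerm κ₁ σ₁)
    (h₂ : SubPerm κ₂ σ₂) : SubPerm (κ₁ * κ₂) (σ₁ * σ₂) :=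
  (subPerm_mul_iff hσ (SubPerm.disjoint hσ h₁ (SubPerm.refl _))
    (SubPerm.disjoint hσ (SubPerm.refl _) h₂) (SubPerm.disjoint hσ h₁ h₂)).2 ⟨h₁, h₂⟩

/-- The support of `σ₁` is a union of cycles of `σ₁σ₂`, hence preserved by `κ`; the first factor is
the restriction of `κ` to it. -/
lemma SubPerm.exists_mul {κ σ₁ σ₂ : Perm (Fin t)} (hσ : σ₁.Disjoint σ₂)
    (h : SubPerm κ (σ₁ * σ₂)) : ∃ κ₁ κ₂, SubPerm κ₁ σ₁ ∧ SubPerm κ₂ σ₂ ∧ κ₁ * κ₂ = κ := by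
  have hf : (fun x => if σ₁ x = x then (0 : ℚ) else 1) ∈ fixedFunctions (σ₁ * σ₂) := by
    intro x
    by_cases hx : σ₁ x = x
    · have h1 : σ₁ (σ₂ x) = σ₂ x := by
        have := DFunLike.congr_fun hσ.commute.eq x
        simpa [hx] using this
      simp [hx, h1]
    · have h1 : σ₂ x = x := (hσ x).resolve_left hx
      simp [hx, h1]
  have hA : ∀ x, σ₁ (κ x) ≠ κ x ↔ σ₁ x ≠ x := by
    intro x
    have := apply_eq_of_sameCycle hf (h.sameCycle_apply x)
    by_cases h1 : σ₁ x = x <;> by_cases h2 : σ₁ (κ x) = κ x <;> simp_all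
  set κ₁ : Perm (Fin t) := ofSubtype (p := fun x => σ₁ x ≠ x) (κ.subtypePerm hA) with hκ₁
  have h1 : ∀ x, σ₁ x ≠ x → κ₁ x = κ x := by
    intro x hx
    rw [hκ₁, ofSubtype_apply_of_mem (p := fun x => σ₁ x ≠ x) _ hx]
    rfl
  have h2 : ∀ x, σ₁ x = x → κ₁ x = x := by
    intro x hx
    rw [hκ₁, ofSubtype_apply_of_not_mem (p := fun x => σ₁ x ≠ x) _ (by simpa using hx)]
  have h3 : ∀ x, σ₁ x ≠ x → (κ₁⁻¹ * κ) x = x := by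
    intro x hx
    rw [Perm.mul_apply, Perm.inv_eq_iff_eq, h1 x hx]
  have h4 : ∀ x, σ₁ x = x → (κ₁⁻¹ * κ) x = κ x := by
    intro x hx
    rw [Perm.mul_apply, Perm.inv_eq_iff_eq, h2]
    have := hA x
    tauto
  have hd1 : κ₁.Disjoint σ₂ := fun x => (hσ x).imp_left (h2 x)
  have hd2 : σ₁.Disjoint (κ₁⁻¹ * κ) := by
    intro x
    by_cases hx : σ₁ x = x
    exacts [Or.inl hx, Or.inr (h3 x hx)]
  have hd3 : κ₁.Disjoint (κ₁⁻¹ * κ) := fun x => (hd2 x).imp_left (h2 x)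
  have h5 : κ₁ * (κ₁⁻¹ * κ) = κ := mul_inv_cancel_left _ _
  have h6 := (subPerm_mul_iff hσ hd1 hd2 hd3).1 (by rwa [h5])
  exact ⟨_, _, h6.1, h6.2, h5⟩

lemma sum_subPerms_mul {M : Type*} [AddCommMonoid M] {σ₁ σ₂ : Perm (Fin t)}
    (hσ : σ₁.Disjoint σ₂) (f : Perm (Fin t) → M) :
    ∑ κ ∈ subPerms (σ₁ * σ₂), f κ =
      ∑ κ₁ ∈ subPerms σ₁, ∑ κ₂ ∈ subPerms σ₂, f (κ₁ * κ₂) := by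
  rw [← Finset.sum_product']
  symm
  refine Finset.sum_bij (fun p _ => p.1 * p.2) ?_ ?_ ?_ ?_
  · intro p hp
    rw [Finset.mem_product, mem_subPerms, mem_subPerms] at hp
    exact mem_subPerms.2 (SubPerm.mul hσ hp.1 hp.2)
  · rintro ⟨a, b⟩ hp ⟨c, d⟩ hq hpq
    simp only [Finset.mem_product, mem_subPerms] at hp hq hpq
    have h1 : a = c := by
      ext1 x
      rcases hσ x with h | h
      · rw [hp.1.apply_eq h, hq.1.apply_eq h]
      · have := DFunLike.congr_fun hpq x
        simpa [hp.2.apply_eq h, hq.2.apply_eq h] using this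
    subst h1
    rw [mul_left_cancel hpq]
  · intro κ hκ
    obtain ⟨κ₁, κ₂, h1, h2, h3⟩ := SubPerm.exists_mul hσ (mem_subPerms.1 hκ)
    exact ⟨(κ₁, κ₂), by simp [mem_subPerms, h1, h2], h3⟩
  · intro p hp
    rfl

lemma sum_subPerms_mul_of_multiplicative {R : Type*} [CommSemiring R] {σ₁ σ₂ : Perm (Fin t)}
    (hσ : σ₁.Disjoint σ₂) {f : Perm (Fin t) → R}
    (hf : ∀ a b : Perm (Fin t), a.Disjoint b → f (a * b) = f a * f b) :
    ∑ κ ∈ subPerms (σ₁ * σ₂), f κ = (∑ κ ∈ subPerms σ₁, f κ) * ∑ κ ∈ subPerms σ₂, f κ := by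
  rw [sum_subPerms_mul hσ, Finset.sum_mul_sum]
  refine Finset.sum_congr rfl fun a ha => Finset.sum_congr rfl fun b hb => ?_
  exact hf _ _ (SubPerm.disjoint hσ (mem_subPerms.1 ha) (mem_subPerms.1 hb))

lemma prod_cycleFactorsFinset_mul {R : Type*} [CommMonoid R] {σ τ : Perm (Fin t)}
    (h : σ.Disjoint τ) (f : Perm (Fin t) → R) :
    ∏ c ∈ (σ * τ).cycleFactorsFinset, f c =
      (∏ c ∈ σ.cycleFactorsFinset, f c) * ∏ c ∈ τ.cycleFactorsFinset, f c := by
  rw [h.cycleFactorsFinset_mul_eq_union, Finset.prod_union h.disjoint_cycleFactorsFinset]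

lemma eq_prod_cycleFactorsFinset {R : Type*} [CommMonoid R] {f : Perm (Fin t) → R}
    (h1 : f 1 = 1) (hf : ∀ a b : Perm (Fin t), a.Disjoint b → f (a * b) = f a * f b)
    (σ : Perm (Fin t)) : f σ = ∏ c ∈ σ.cycleFactorsFinset, f c := by
  induction σ using cycle_induction_on with
  | base_one => simp [h1]
  | base_cycles σ hσ => rw [hσ.cycleFactorsFinset_eq_singleton, Finset.prod_singleton]
  | induction_disjoint σ τ hd _ h2 h3 => rw [hf _ _ hd, prod_cycleFactorsFinset_mul hd, h2, h3]

/-! ### Cycles as lists -/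

/-- The cut yields consecutive arcs starting at `a` and at `j`. Letting `j` run along the list
indexes the cuts by arc length, the source of all the convolutions over cycles. -/
lemma formPerm_cons_eq_swap_mul {a : Fin t} {L₁ : List (Fin t)} {j : Fin t} {L₂ : List (Fin t)}
    (h : (a :: (L₁ ++ j :: L₂)).Nodup) :
    swap a j * (a :: (L₁ ++ j :: L₂)).formPerm = (a :: L₁).formPerm * (j :: L₂).formPerm := by
  induction L₁ generalizing a with
  | nil => simp [List.formPerm_cons_cons, ← mul_assoc]
  | cons b L ih =>
    have h1 := ih (a := b) (List.nodup_cons.1 h).2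
    have hab : a ≠ b := by rintro rfl; simp at h
    have haj : a ≠ j := by rintro rfl; simp at h
    have hbj : b ≠ j := by rintro rfl; simp at h
    have h2 : (b :: (L ++ j :: L₂)).formPerm =
        swap b j * ((b :: L).formPerm * (j :: L₂).formPerm) := by
      rw [← h1, ← mul_assoc, swap_mul_self, one_mul]
    have h3 : swap a j * (swap a b * swap b j) = swap a b := by
      have h4 : swap a b * swap b j = swap a j * swap a b := by
        rw [Equiv.mul_swap_eq_swap_mul, swap_apply_right,
          swap_apply_of_ne_of_ne haj.symm hbj.symm]
      rw [h4, ← mul_assoc, swap_mul_self, one_mul]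
    rw [List.cons_append, List.formPerm_cons_cons, h2, List.formPerm_cons_cons]
    nth_rewrite 2 [← h3]
    simp only [mul_assoc]

lemma disjoint_formPerm {L₁ L₂ : List (Fin t)} (h : L₁.Disjoint L₂) :
    L₁.formPerm.Disjoint L₂.formPerm := by
  intro x
  by_cases hx : x ∈ L₁
  · exact Or.inr (List.formPerm_apply_of_notMem (h hx))
  · exact Or.inl (List.formPerm_apply_of_notMem hx)

lemma deletePoint_formPerm_cons {a : Fin t} {L : List (Fin t)} (h : (a :: L).Nodup) :
    deletePoint (a :: L).formPerm a = L.formPerm := by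
  cases L with
  | nil =>
    have h1 : swap a a = (1 : Perm (Fin t)) := swap_self a
    simp only [deletePoint, List.formPerm_singleton, List.formPerm_nil, Perm.one_apply, h1, mul_one]
  | cons b L =>
    rw [deletePoint, List.formPerm_apply_head a b L h, List.formPerm_cons_cons, ← mul_assoc,
      swap_mul_self, one_mul]

lemma permSize_formPerm_cons {a : Fin t} {L : List (Fin t)} (h : (a :: L).Nodup) :
    permSize (a :: L).formPerm = L.length := by
  induction L generalizing a with
  | nil => simp
  | cons b L ih =>
    have h1 : (b :: L).formPerm a = a :=
      List.formPerm_apply_of_notMem (List.nodup_cons.1 h).1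
    have h2 : ¬ (b :: L).formPerm.SameCycle a b := by
      intro h3
      have := eq_of_sameCycle_of_apply_eq h1 h3
      subst this
      simp at h
    rw [List.formPerm_cons_cons, permSize_swap_mul_of_not_sameCycle h2,
      ih (List.nodup_cons.1 h).2, List.length_cons]

lemma sameCycle_formPerm_cons {a j : Fin t} {L : List (Fin t)} (h : (a :: L).Nodup) :
    (a :: L).formPerm.SameCycle a j ↔ j ∈ a :: L := by
  constructor
  · intro hj
    by_contra h1
    have := eq_of_sameCycle_of_apply_eq (List.formPerm_apply_of_notMem h1) hj.symm
    subst this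
    simp at h1
  · intro hj
    cases L with
    | nil => simp at hj; subst hj; exact SameCycle.refl _ _
    | cons b L =>
      have h1 := List.isCycle_formPerm h (by simp)
      refine h1.sameCycle ?_ ?_
      · exact (List.formPerm_apply_mem_ne_self_iff _ h _ (by simp)).2 (by simp)
      · exact (List.formPerm_apply_mem_ne_self_iff _ h _ hj).2 (by simp)

lemma exists_formPerm_cons {σ : Perm (Fin t)} {i : Fin t} (h : σ i ≠ i) :
    ∃ L : List (Fin t), (i :: L).Nodup ∧ L ≠ [] ∧ (i :: L).formPerm = σ.cycleOf i ∧
      L.length + 1 = (σ.cycleOf i).support.card := by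
  have h1 : i ∈ σ.support := mem_support.2 h
  obtain ⟨a, L, hL⟩ := List.exists_cons_of_length_pos (length_toList_pos_of_mem_support σ i h1)
  have h2 : a = i := by
    have := toList_getElem_zero σ i h1
    simpa [hL] using this
  subst h2
  refine ⟨L, hL ▸ nodup_toList σ a, ?_, by rw [← hL, formPerm_toList], ?_⟩
  · rintro rfl
    exact toList_ne_singleton σ a a hL
  · rw [← length_toList, hL, List.length_cons]

/-- A permutation that moves `i`, split into the cycle of `i` and the rest. -/
lemma exists_eq_formPerm_mul {σ : Perm (Fin t)} {i : Fin t} (h : σ i ≠ i) :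
    ∃ (L : List (Fin t)) (ρ : Perm (Fin t)), (i :: L).Nodup ∧ L ≠ [] ∧
      (∀ x ∈ i :: L, ρ x = x) ∧ σ = (i :: L).formPerm * ρ := by
  obtain ⟨L, hn, hL, hc, -⟩ := exists_formPerm_cons h
  have h1 : σ.cycleOf i ∈ σ.cycleFactorsFinset :=
    cycleOf_mem_cycleFactorsFinset_iff.2 (mem_support.2 h)
  have h2 := disjoint_mul_inv_of_mem_cycleFactorsFinset h1
  refine ⟨L, σ * (σ.cycleOf i)⁻¹, hn, hL, ?_, ?_⟩
  · intro x hx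
    refine (h2 x).resolve_right ?_
    rw [← hc]
    refine (List.formPerm_apply_mem_ne_self_iff _ hn _ hx).2 ?_
    cases L with
    | nil => simp at hL
    | cons => simp
  · rw [hc, ← h2.commute.eq]
    simp

lemma disjoint_formPerm_of_fixed {L : List (Fin t)} {ρ : Perm (Fin t)} (h : ∀ x ∈ L, ρ x = x) :
    L.formPerm.Disjoint ρ := by
  intro x
  by_cases hx : x ∈ L
  exacts [Or.inr (h x hx), Or.inl (List.formPerm_apply_of_notMem hx)]

lemma IsCycle.exists_formPerm {c : Perm (Fin t)} (hc : c.IsCycle) :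
    ∃ (i : Fin t) (L : List (Fin t)), (i :: L).Nodup ∧ L ≠ [] ∧ (i :: L).formPerm = c ∧
      L.length + 1 = c.support.card ∧ c i ≠ i := by
  obtain ⟨i, hi, -⟩ := id hc
  obtain ⟨L, hn, hL, h1, h2⟩ := exists_formPerm_cons hi
  rw [hc.cycleOf_eq hi] at h1 h2
  exact ⟨i, L, hn, hL, h1, h2, hi⟩

lemma permSize_add_one_of_isCycle {c : Perm (Fin t)} (hc : c.IsCycle) :
    permSize c + 1 = c.support.card := by
  obtain ⟨i, L, hn, -, rfl, h, -⟩ := IsCycle.exists_formPerm hc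
  rw [permSize_formPerm_cons hn, h]

/-- Turns a sum over cut points into a sum over the length of the arc before the cut. -/
lemma sum_toFinset_eq_sum_range {M α : Type*} [AddCommMonoid M] [DecidableEq α] {L : List α}
    (hL : L.Nodup) {g : α → M} {h : ℕ → M}
    (hg : ∀ L₁ j L₂, L = L₁ ++ j :: L₂ → g j = h L₁.length) :
    ∑ j ∈ L.toFinset, g j = ∑ k ∈ Finset.range L.length, h k := by
  rw [List.sum_toFinset _ hL]
  clear hL
  induction L generalizing h with
  | nil => simp
  | cons a L ih =>
    have h1 := ih (h := fun k => h (k + 1)) (fun L₁ j L₂ hL => by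
      have := hg (a :: L₁) j L₂ (by simp [hL])
      simpa using this)
    have h2 : g a = h 0 := by simpa using hg [] a L (by simp)
    rw [List.map_cons, List.sum_cons, h1, h2, List.length_cons, Finset.sum_range_succ', add_comm]

/-! ### Counting sub-permutations -/

lemma filter_subPerms_apply_self (σ : Perm (Fin t)) (a : Fin t) :
    (subPerms σ).filter (fun κ => κ a = a) = subPerms (deletePoint σ a) := by
  ext κ
  rw [Finset.mem_filter, mem_subPerms, mem_subPerms, subPerm_deletePoint_iff]

/-- Left multiplication by `swap a j` turns "sends `a` to `j`" into "fixes `a`", and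
sub-permutations of `σ` into those of the cut permutation. -/
lemma card_filter_subPerms_apply {σ : Perm (Fin t)} {a j : Fin t} (haj : a ≠ j)
    (h : σ.SameCycle a j) :
    ((subPerms σ).filter (fun κ => κ a = j)).card =
      (subPerms (deletePoint (swap a j * σ) a)).card := by
  refine Finset.card_bij' (fun κ _ => swap a j * κ) (fun κ _ => swap a j * κ) ?_ ?_ ?_ ?_
  · intro κ hκ
    rw [Finset.mem_filter, mem_subPerms] at hκ
    have h1 : (swap a j * κ) a = a := by simp [hκ.2]
    rw [mem_subPerms, subPerm_deletePoint_iff, subPerm_of_swap_mul haj h]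
    · rw [← mul_assoc, swap_mul_self, one_mul]
      exact ⟨hκ.1, h1⟩
    · exact fun h2 => haj.symm (eq_of_sameCycle_of_apply_eq h1 h2)
  · intro ρ hρ
    rw [mem_subPerms, subPerm_deletePoint_iff] at hρ
    rw [Finset.mem_filter, mem_subPerms, ← subPerm_of_swap_mul haj h]
    · exact ⟨hρ.1, by simp [hρ.2]⟩
    · exact fun h2 => haj.symm (eq_of_sameCycle_of_apply_eq hρ.2 h2)
  · intro κ _
    rw [← mul_assoc, swap_mul_self, one_mul]
  · intro κ _
    rw [← mul_assoc, swap_mul_self, one_mul]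

lemma card_subPerms_mul {σ τ : Perm (Fin t)} (h : σ.Disjoint τ) :
    (subPerms (σ * τ)).card = (subPerms σ).card * (subPerms τ).card := by
  simp only [Finset.card_eq_sum_ones]
  exact sum_subPerms_mul_of_multiplicative h (f := fun _ => 1) (by simp)

lemma deletePoint_swap_mul_formPerm {a j : Fin t} {L₁ L₂ : List (Fin t)}
    (h : (a :: (L₁ ++ j :: L₂)).Nodup) :
    deletePoint (swap a j * (a :: (L₁ ++ j :: L₂)).formPerm) a =
      L₁.formPerm * (j :: L₂).formPerm := by
  have h1 : a ∉ j :: L₂ := fun h' => (List.nodup_cons.1 h).1 (List.mem_append_right _ h')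
  have h2 : (a :: L₁).Nodup := by
    rw [← List.cons_append] at h
    exact h.of_append_left
  rw [formPerm_cons_eq_swap_mul h, ← deletePoint_formPerm_cons h2, deletePoint, deletePoint,
    mul_assoc, Perm.mul_apply, List.formPerm_apply_of_notMem h1]

/-- Classifying `κ` by `κ a` gives the Catalan recursion: `κ a = j` leaves independent choices on
the arcs before and from `j`, while `κ a = a` supplies the top term, with `catalan 0`. -/
lemma card_subPerms_formPerm (L : List (Fin t)) (hL : L.Nodup) :
    (subPerms L.formPerm).card = catalan L.length := by
  obtain ⟨n, hn⟩ : ∃ n, L.length = n := ⟨_, rfl⟩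
  induction n using Nat.strong_induction_on generalizing L with
  | _ n ih =>
  cases L with
  | nil =>
    have : subPerms (1 : Perm (Fin t)) = {1} := by ext; simp [mem_subPerms, subPerm_one_right]
    simp [this]
  | cons a L =>
    have hmaps : ∀ κ ∈ subPerms (a :: L).formPerm, κ a ∈ (a :: L).toFinset := by
      intro κ hκ
      rw [List.mem_toFinset, ← sameCycle_formPerm_cons hL]
      exact (mem_subPerms.1 hκ).sameCycle_apply a
    have haL : a ∉ L := (List.nodup_cons.1 hL).1
    have hL' : L.Nodup := (List.nodup_cons.1 hL).2
    rw [Finset.card_eq_sum_card_fiberwise hmaps, List.toFinset_cons,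
      Finset.sum_insert (by simpa using haL), filter_subPerms_apply_self,
      deletePoint_formPerm_cons hL, ih L.length (by simp [← hn]) L hL' rfl,
      sum_toFinset_eq_sum_range hL'
        (h := fun k => catalan k * catalan (L.length - k)), List.length_cons, catalan_succ,
      Finset.sum_fin_eq_sum_range, Finset.sum_range_succ, add_comm]
    · congr 1
      · refine Finset.sum_congr rfl fun k hk => ?_
        rw [dif_pos (by have := Finset.mem_range.1 hk; omega)]
      · simp
    · rintro L₁ j L₂ rfl
      have haj : a ≠ j := by rintro rfl; simp at haL
      have hd : L₁.Disjoint (j :: L₂) := List.disjoint_of_nodup_append hL'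
      simp only [List.length_cons, List.length_append] at hn
      rw [card_filter_subPerms_apply haj ((sameCycle_formPerm_cons hL).2 (by simp)),
        deletePoint_swap_mul_formPerm hL, card_subPerms_mul (disjoint_formPerm hd),
        ih _ (by omega) L₁ hL'.of_append_left rfl,
        ih _ (by simp only [List.length_cons]; omega) (j :: L₂) hL'.of_append_right rfl]
      simp

lemma card_subPerms_of_isCycle {c : Perm (Fin t)} (hc : c.IsCycle) :
    (subPerms c).card = catalan c.support.card := by
  obtain ⟨i, L, hn, -, rfl, h, -⟩ := IsCycle.exists_formPerm hc
  rw [card_subPerms_formPerm _ hn, ← h, List.length_cons]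

lemma card_subPerms_one : (subPerms (1 : Perm (Fin t))).card = 1 := by
  simpa using card_subPerms_formPerm (t := t) [] List.nodup_nil

lemma card_subPerms (σ : Perm (Fin t)) : (subPerms σ).card = catalanProd σ := by
  rw [eq_prod_cycleFactorsFinset (f := fun σ : Perm (Fin t) => (subPerms σ).card)
    card_subPerms_one (fun a b => card_subPerms_mul) σ]
  exact Finset.prod_congr rfl fun c hc =>
    card_subPerms_of_isCycle (mem_cycleFactorsFinset_iff.1 hc).1

/-! ### The Möbius function -/

@[simp] lemma mobius_one : mobius (1 : Perm (Fin t)) = 1 := by simp [mobius]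

lemma mobius_mul {σ τ : Perm (Fin t)} (h : σ.Disjoint τ) :
    mobius (σ * τ) = mobius σ * mobius τ :=
  prod_cycleFactorsFinset_mul h _

lemma mobius_of_isCycle {c : Perm (Fin t)} (hc : c.IsCycle) :
    mobius c = (-1) ^ permSize c * (catalan (permSize c) : ℤ) := by
  rw [mobius, hc.cycleFactorsFinset_eq_singleton, Finset.prod_singleton]

lemma mobius_formPerm_cons {a : Fin t} {L : List (Fin t)} (h : (a :: L).Nodup) :
    mobius (a :: L).formPerm = (-1) ^ L.length * (catalan L.length : ℤ) := by
  cases L with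
  | nil => simp
  | cons b L =>
    rw [mobius_of_isCycle (List.isCycle_formPerm h (by simp)), permSize_formPerm_cons h]

/-- The points other than `i` in the cycle of `i`. -/
def cycleMates (σ : Perm (Fin t)) (i : Fin t) : Finset (Fin t) :=
  Finset.univ.filter fun j => i ≠ j ∧ σ.SameCycle i j

lemma mem_cycleMates {σ : Perm (Fin t)} {i j : Fin t} :
    j ∈ cycleMates σ i ↔ i ≠ j ∧ σ.SameCycle i j := by simp [cycleMates]

lemma cycleMates_of_apply_eq {σ : Perm (Fin t)} {i : Fin t} (h : σ i = i) :
    cycleMates σ i = ∅ := by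
  refine Finset.eq_empty_of_forall_notMem fun j hj => ?_
  rw [mem_cycleMates] at hj
  exact hj.1 (eq_of_sameCycle_of_apply_eq h hj.2).symm

lemma cycleMates_formPerm_cons {i : Fin t} {L : List (Fin t)} (h : (i :: L).Nodup) :
    cycleMates (i :: L).formPerm i = L.toFinset := by
  ext j
  rw [mem_cycleMates, sameCycle_formPerm_cons h, List.mem_toFinset, List.mem_cons]
  have := (List.nodup_cons.1 h).1
  constructor
  · rintro ⟨h1, h2⟩
    exact h2.resolve_left (Ne.symm h1)
  · intro hj
    exact ⟨by rintro rfl; exact this hj, Or.inr hj⟩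

lemma cycleMates_mul_of_disjoint {σ ρ : Perm (Fin t)} {i : Fin t} (hd : σ.Disjoint ρ)
    (h : ρ i = i) : cycleMates (σ * ρ) i = cycleMates σ i := by
  ext j
  rw [mem_cycleMates, mem_cycleMates]
  have h1 : ∀ k : ℤ, ((σ * ρ) ^ k) i = (σ ^ k) i := by
    intro k
    rw [hd.commute.mul_zpow, Perm.mul_apply, zpow_apply_eq_self_of_apply_eq_self h]
  simp only [SameCycle, h1]

lemma sum_catalan_mul_catalan (n : ℕ) :
    ∑ k ∈ Finset.range (n + 1), catalan k * catalan (n - k) = catalan (n + 1) := by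
  rw [catalan_succ, Finset.sum_fin_eq_sum_range]
  refine Finset.sum_congr rfl fun k hk => ?_
  rw [dif_pos (Finset.mem_range.1 hk)]

lemma sum_signed_catalan (n : ℕ) :
    ∑ k ∈ Finset.range (n + 1), ((-1) ^ k * (catalan k : ℤ)) *
      ((-1) ^ (n - k) * (catalan (n - k) : ℤ)) = (-1) ^ n * (catalan (n + 1) : ℤ) := by
  rw [← sum_catalan_mul_catalan, Nat.cast_sum, Finset.mul_sum]
  refine Finset.sum_congr rfl fun k hk => ?_
  have hk := Finset.mem_range.1 hk
  have : (-1 : ℤ) ^ n = (-1) ^ k * (-1) ^ (n - k) := by rw [← pow_add]; congr 1; omega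
  rw [this]
  push_cast
  ring

/-- Summing over all ways to cut a cycle open at a given point. -/
lemma sum_mobius_swap_mul {κ : Perm (Fin t)} {i : Fin t} (h : κ i ≠ i) :
    ∑ j ∈ cycleMates κ i, mobius (swap i j * κ) = - mobius κ := by
  obtain ⟨L, ρ, hn, hL, hρ, rfl⟩ := exists_eq_formPerm_mul h
  have hd := disjoint_formPerm_of_fixed hρ
  have hL' : L.Nodup := (List.nodup_cons.1 hn).2
  -- The arcs have sizes `k` and `L.length - 1 - k`, one less than their lengths. The sizes
  -- therefore add up to `|κ| - 1` on this cycle, which produces the minus sign.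
  rw [cycleMates_mul_of_disjoint hd (hρ i (by simp)), cycleMates_formPerm_cons hn,
    sum_toFinset_eq_sum_range hL' (h := fun k => ((-1) ^ k * (catalan k : ℤ)) *
      ((-1) ^ (L.length - 1 - k) * (catalan (L.length - 1 - k) : ℤ)) * mobius ρ),
    ← Finset.sum_mul, mobius_mul hd, mobius_formPerm_cons hn]
  · obtain ⟨n, hn⟩ : ∃ n, L.length = n + 1 :=
      Nat.exists_eq_succ_of_ne_zero (by simpa using hL)
    rw [hn, Nat.add_sub_cancel, sum_signed_catalan]
    ring
  · rintro L₁ j L₂ rfl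
    have hn1 : (i :: L₁).Nodup := by
      rw [← List.cons_append] at hn
      exact hn.of_append_left
    have hn2 : (j :: L₂).Nodup := hL'.of_append_right
    have hdj : (i :: L₁).Disjoint (j :: L₂) := by
      rw [← List.cons_append] at hn
      exact List.disjoint_of_nodup_append hn
    have hd1 : (i :: L₁).formPerm.Disjoint ρ :=
      disjoint_formPerm_of_fixed fun x hx => hρ x (by simp at hx ⊢; tauto)
    have hd2 : (j :: L₂).formPerm.Disjoint ρ :=
      disjoint_formPerm_of_fixed fun x hx => hρ x (by simp at hx ⊢; tauto)
    rw [← mul_assoc, formPerm_cons_eq_swap_mul hn, mobius_mul (Disjoint.mul_left hd1 hd2),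
      mobius_mul (disjoint_formPerm hdj), mobius_formPerm_cons hn1, mobius_formPerm_cons hn2]
    have h3 : (L₁ ++ j :: L₂).length - 1 - L₁.length = L₂.length := by
      simp only [List.length_append, List.length_cons]; omega
    rw [h3]

/-! ### The characteristic polynomial of the interval below a permutation -/

section CharPoly

variable {R : Type*} [CommRing R] (x : R)

/-- The weight `μ(κ) x^{|κ|}`. -/
def mobiusWeight (κ : Perm (Fin t)) : R := (mobius κ : R) * x ^ permSize κ

/-- `∑_{κ ⊆ σ} μ(κ) x^{|κ|}`. -/
def charSum (σ : Perm (Fin t)) : R := ∑ κ ∈ subPerms σ, mobiusWeight x κ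

lemma mobiusWeight_mul {σ τ : Perm (Fin t)} (h : σ.Disjoint τ) :
    mobiusWeight x (σ * τ) = mobiusWeight x σ * mobiusWeight x τ := by
  unfold mobiusWeight
  rw [mobius_mul h, permSize_mul_of_disjoint h, pow_add]
  push_cast
  ring

lemma charSum_mul {σ τ : Perm (Fin t)} (h : σ.Disjoint τ) :
    charSum x (σ * τ) = charSum x σ * charSum x τ :=
  sum_subPerms_mul_of_multiplicative h fun _ _ => mobiusWeight_mul x

lemma subPerms_one : subPerms (1 : Perm (Fin t)) = {1} := by
  ext; simp [mem_subPerms, subPerm_one_right]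

@[simp] lemma charSum_one : charSum x (1 : Perm (Fin t)) = 1 := by
  simp [charSum, subPerms_one, mobiusWeight]

/-- Cutting is undone by rejoining: a sub-permutation of `swap i j * σ` cannot connect `i` and `j`.
-/
lemma sum_filter_subPerms_sameCycle {M : Type*} [AddCommMonoid M] {σ : Perm (Fin t)} {i j : Fin t}
    (hij : i ≠ j) (h : σ.SameCycle i j) (f : Perm (Fin t) → M) :
    ∑ κ ∈ (subPerms σ).filter (fun κ => κ.SameCycle i j), f (swap i j * κ) =
      ∑ ρ ∈ subPerms (swap i j * σ), f ρ := by
  refine Finset.sum_bij' (fun κ _ => swap i j * κ) (fun κ _ => swap i j * κ) ?_ ?_ ?_ ?_ ?_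
  · intro κ hκ
    rw [Finset.mem_filter, mem_subPerms] at hκ
    exact mem_subPerms.2 ((subPerm_swap_mul_iff hij hκ.2 h).2 hκ.1)
  · intro ρ hρ
    rw [mem_subPerms] at hρ
    have h1 : ¬ ρ.SameCycle i j := fun h2 => not_sameCycle_swap_mul hij h (hρ.sameCycle h2)
    rw [Finset.mem_filter, mem_subPerms]
    exact ⟨(subPerm_of_swap_mul hij h h1).1 hρ, sameCycle_swap_mul h1⟩
  · intro κ _
    rw [← mul_assoc, swap_mul_self, one_mul]
  · intro κ _
    rw [← mul_assoc, swap_mul_self, one_mul]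
  · intro κ _
    rfl

lemma mobiusWeight_eq_sum {κ : Perm (Fin t)} {i : Fin t} (h : κ i ≠ i) :
    mobiusWeight x κ = - x * ∑ j ∈ cycleMates κ i, mobiusWeight x (swap i j * κ) := by
  have h1 := sum_mobius_swap_mul h
  have h2 : (mobius κ : R) = - ∑ j ∈ cycleMates κ i, (mobius (swap i j * κ) : R) := by
    rw [← Int.cast_sum, h1]; simp
  rw [mobiusWeight, h2, neg_mul, neg_mul, Finset.sum_mul, Finset.mul_sum]
  congr 1
  refine Finset.sum_congr rfl fun j hj => ?_
  rw [mem_cycleMates] at hj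
  rw [mobiusWeight, ← permSize_swap_mul_of_sameCycle hj.1 hj.2, pow_succ]
  ring

/-- Terms fixing `i` give the sum for `σ` with `i` deleted. In the others the weight is expanded
over the cuts of the cycle of `i`; exchanging the sums, each `j` contributes the sum for `σ` cut at
`i` and `j`. -/
lemma charSum_eq (σ : Perm (Fin t)) (i : Fin t) :
    charSum x σ = charSum x (deletePoint σ i) -
      x * ∑ j ∈ cycleMates σ i, charSum x (swap i j * σ) := by
  have h1 : ∑ κ ∈ (subPerms σ).filter (fun κ => ¬ κ i = i), mobiusWeight x κ =
      - x * ∑ κ ∈ subPerms σ, ∑ j ∈ cycleMates κ i, mobiusWeight x (swap i j * κ) := by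
    rw [Finset.mul_sum, Finset.sum_filter]
    refine Finset.sum_congr rfl fun κ hκ => ?_
    split_ifs with h
    · rw [cycleMates_of_apply_eq h]; simp
    · exact mobiusWeight_eq_sum x h
  have h2 : ∑ κ ∈ subPerms σ, ∑ j ∈ cycleMates κ i, mobiusWeight x (swap i j * κ) =
      ∑ j ∈ cycleMates σ i, charSum x (swap i j * σ) := by
    rw [Finset.sum_comm' (s' := fun j => (subPerms σ).filter (fun κ => κ.SameCycle i j))
      (t' := cycleMates σ i)]
    · refine Finset.sum_congr rfl fun j hj => ?_
      rw [mem_cycleMates] at hj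
      rw [sum_filter_subPerms_sameCycle hj.1 hj.2, charSum]
    · intro κ j
      rw [Finset.mem_filter, mem_subPerms, mem_cycleMates, mem_cycleMates]
      exact ⟨fun h => ⟨⟨h.1, h.2.2⟩, h.2.1, h.1.sameCycle h.2.2⟩,
        fun h => ⟨h.1.1, h.2.1, h.1.2⟩⟩
  rw [charSum, ← Finset.sum_filter_add_sum_filter_not _ (fun κ : Perm (Fin t) => κ i = i),
    filter_subPerms_apply_self, h1, h2, charSum]
  ring

/-- The value of `∑_{κ ⊆ σ} μ(κ) x^{|κ|}` at a cycle `σ` of length `n`. -/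
def cycleSum : ℕ → R
  | 0 => 1
  | n + 1 => cycleSum n - x * ∑ k : Fin n, cycleSum (k + 1) * cycleSum (n - k)

lemma cycleSum_zero : cycleSum x 0 = 1 := by rw [cycleSum]

lemma cycleSum_succ (n : ℕ) : cycleSum x (n + 1) =
    cycleSum x n - x * ∑ k ∈ Finset.range n, cycleSum x (k + 1) * cycleSum x (n - k) := by
  rw [cycleSum, Finset.sum_fin_eq_sum_range]
  congr 2
  refine Finset.sum_congr rfl fun k hk => ?_
  rw [dif_pos (Finset.mem_range.1 hk)]

lemma charSum_formPerm (L : List (Fin t)) (hL : L.Nodup) :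
    charSum x L.formPerm = cycleSum x L.length := by
  obtain ⟨n, hn⟩ : ∃ n, L.length = n := ⟨_, rfl⟩
  induction n using Nat.strong_induction_on generalizing L with
  | _ n ih =>
  cases L with
  | nil => simp [cycleSum_zero]
  | cons i L =>
    have hL' : L.Nodup := (List.nodup_cons.1 hL).2
    rw [charSum_eq x _ i, deletePoint_formPerm_cons hL, cycleMates_formPerm_cons hL,
      List.length_cons, cycleSum_succ, ih L.length (by simp [← hn]) L hL' rfl,
      sum_toFinset_eq_sum_range hL'
        (h := fun k => cycleSum x (k + 1) * cycleSum x (L.length - k))]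
    rintro L₁ j L₂ rfl
    simp only [List.length_cons, List.length_append] at hn
    rw [formPerm_cons_eq_swap_mul hL]
    rw [← List.cons_append] at hL
    rw [charSum_mul x (disjoint_formPerm (List.disjoint_of_nodup_append hL)),
      ih _ (by simp only [List.length_cons]; omega) (i :: L₁) hL.of_append_left rfl,
      ih _ (by simp only [List.length_cons]; omega) (j :: L₂) hL.of_append_right rfl]
    simp

lemma charSum_of_isCycle {c : Perm (Fin t)} (hc : c.IsCycle) :
    charSum x c = cycleSum x c.support.card := by
  obtain ⟨i, L, hn, -, rfl, h, -⟩ := IsCycle.exists_formPerm hc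
  rw [charSum_formPerm x _ hn, ← h, List.length_cons]

lemma charSum_deletePoint_of_isCycle {c : Perm (Fin t)} (hc : c.IsCycle) {i : Fin t}
    (hi : c i ≠ i) : charSum x (deletePoint c i) = cycleSum x (c.support.card - 1) := by
  obtain ⟨L, hn, -, h1, h2⟩ := exists_formPerm_cons hi
  rw [hc.cycleOf_eq hi] at h1 h2
  rw [← h2, ← h1, deletePoint_formPerm_cons hn, charSum_formPerm x _ (List.nodup_cons.1 hn).2,
    Nat.add_sub_cancel]

end CharPoly

/-! ### Möbius inversion -/

/-- Length two gives `1 - 1`. Beyond it, every product in the recursion has a factor of length at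
least two, which already vanishes. -/
lemma cycleSum_one_arg (n : ℕ) : cycleSum (1 : ℤ) (n + 2) = 0 := by
  have h1 : cycleSum (1 : ℤ) 1 = 1 := by rw [cycleSum_succ, cycleSum_zero]; simp
  induction n using Nat.strong_induction_on with
  | _ n ih =>
  rw [cycleSum_succ, one_mul, Finset.sum_range_succ']
  cases n with
  | zero => simp [h1]
  | succ n =>
    rw [Finset.sum_eq_single n]
    · have := ih n (by omega)
      simp [this]
    · intro k hk hkn
      rw [ih k (by have := Finset.mem_range.1 hk; omega), zero_mul]
    · simp

lemma sum_mobius_subPerms (σ : Perm (Fin t)) :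
    ∑ κ ∈ subPerms σ, mobius κ = if σ = 1 then 1 else 0 := by
  have h0 : ∀ σ : Perm (Fin t), ∑ κ ∈ subPerms σ, mobius κ = charSum (1 : ℤ) σ := by
    intro σ; simp [charSum, mobiusWeight]
  rw [h0]
  split_ifs with h
  · simp [h]
  · rw [eq_prod_cycleFactorsFinset (f := charSum (1 : ℤ)) (charSum_one _) (fun _ _ => charSum_mul _) σ]
    obtain ⟨c, hc⟩ := Finset.nonempty_iff_ne_empty.2 (mt cycleFactorsFinset_eq_empty_iff.1 h)
    have hc' := (mem_cycleFactorsFinset_iff.1 hc).1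
    refine Finset.prod_eq_zero hc ?_
    rw [charSum_of_isCycle _ hc']
    obtain ⟨n, hn⟩ := Nat.exists_eq_add_of_le' hc'.two_le_card_support
    rw [hn, cycleSum_one_arg]

lemma phi_apply (σ π : Perm (Fin t)) :
    phi t σ π = if SubPerm π σ then mobius (π⁻¹ * σ) else 0 := rfl

lemma zeta_apply (σ π : Perm (Fin t)) : zeta t σ π = if SubPerm π σ then 1 else 0 := rfl

lemma phi_self (σ : Perm (Fin t)) : phi t σ σ = 1 := by
  rw [phi_apply, if_pos (SubPerm.refl σ), inv_mul_cancel, mobius_one]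

lemma phi_mul_zeta (t : ℕ) : phi t * zeta t = 1 := by
  ext σ π
  rw [Matrix.mul_apply, Matrix.one_apply]
  have h1 : ∀ ρ : Perm (Fin t), phi t σ ρ * zeta t ρ π =
      if SubPerm π σ ∧ SubPerm (ρ⁻¹ * σ) (π⁻¹ * σ) then mobius (ρ⁻¹ * σ) else 0 := by
    intro ρ
    rw [phi_apply, zeta_apply]
    simp only [← interval_iff]
    by_cases h2 : SubPerm π ρ <;> by_cases h3 : SubPerm ρ σ <;> simp [h2, h3]
  simp only [h1]
  by_cases h : SubPerm π σ
  · have h2 : ∑ ρ : Perm (Fin t), (if SubPerm π σ ∧ SubPerm (ρ⁻¹ * σ) (π⁻¹ * σ) then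
        mobius (ρ⁻¹ * σ) else 0) = ∑ κ ∈ subPerms (π⁻¹ * σ), mobius κ := by
      rw [subPerms, Finset.sum_filter]
      -- The substitution `κ = ρ⁻¹σ` carries the interval to the sub-permutations of `π⁻¹σ`.
      refine Fintype.sum_equiv ((Equiv.inv _).trans (Equiv.mulRight σ)) _ _ fun ρ => ?_
      simp [h]
    rw [h2, sum_mobius_subPerms]
    simp only [inv_mul_eq_one, eq_comm (a := π)]
  · have h2 : σ ≠ π := by rintro rfl; exact h (SubPerm.refl _)
    simp [h, h2]

lemma zeta_mul_phi (t : ℕ) : zeta t * phi t = 1 :=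
  mul_eq_one_comm.1 (phi_mul_zeta t)

lemma sum_zeta_smul {M : Type*} [AddCommGroup M] (g : Perm (Fin t) → M) (σ : Perm (Fin t)) :
    ∑ π ∈ subPerms σ, g π = ∑ π, zeta t σ π • g π := by
  rw [subPerms, Finset.sum_filter]
  refine Finset.sum_congr rfl fun π _ => ?_
  rw [zeta_apply]
  split_ifs <;> simp

lemma sum_phi_smul {M : Type*} [AddCommGroup M] (g : Perm (Fin t) → M) (σ : Perm (Fin t)) :
    ∑ π ∈ subPerms σ, phi t σ π • g π = ∑ π, phi t σ π • g π := by
  rw [subPerms, Finset.sum_filter]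
  refine Finset.sum_congr rfl fun π _ => ?_
  rw [phi_apply]
  split_ifs <;> simp

lemma sum_smul_sum_smul {M : Type*} [AddCommGroup M]
    {A B : Matrix (Perm (Fin t)) (Perm (Fin t)) ℤ} (h : A * B = 1) (g : Perm (Fin t) → M)
    (σ : Perm (Fin t)) : ∑ π, A σ π • ∑ ρ, B π ρ • g ρ = g σ := by
  simp only [Finset.smul_sum, smul_smul]
  rw [Finset.sum_comm]
  simp only [← Finset.sum_smul, ← Matrix.mul_apply, h, Matrix.one_apply]
  simp

/-- Möbius inversion for the order of sub-permutations. -/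
lemma mobius_inversion {M : Type*} [AddCommGroup M] (f g : Perm (Fin t) → M) :
    (∀ σ, f σ = ∑ π ∈ subPerms σ, g π) ↔
      ∀ σ, g σ = ∑ π ∈ subPerms σ, phi t σ π • f π := by
  simp only [sum_phi_smul]
  simp only [sum_zeta_smul]
  constructor
  · intro h σ
    simp only [h]
    rw [sum_smul_sum_smul (phi_mul_zeta t)]
  · intro h σ
    simp only [h]
    rw [sum_smul_sum_smul (zeta_mul_phi t)]

/-! ### Consecutive cycle sums do not both vanish -/

section CycleSeries

open PowerSeries

variable (x : ℝ)

/-- The generating function of the cycle sums of positive length. -/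
def cycleSeries : PowerSeries ℝ := PowerSeries.mk fun n => if n = 0 then 0 else cycleSum x n

lemma coeff_cycleSeries_zero : coeff 0 (cycleSeries x) = 0 := by simp [cycleSeries]

lemma coeff_cycleSeries_succ (n : ℕ) : coeff (n + 1) (cycleSeries x) = cycleSum x (n + 1) := by
  simp [cycleSeries]

lemma coeff_cycleSeries_sq (n : ℕ) : coeff (n + 1) (cycleSeries x ^ 2) =
    ∑ k ∈ Finset.range n, cycleSum x (k + 1) * cycleSum x (n - k) := by
  rw [pow_two, coeff_mul, Finset.Nat.sum_antidiagonal_eq_sum_range_succ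
    (fun i j => coeff i (cycleSeries x) * coeff j (cycleSeries x)), Finset.sum_range_succ,
    Finset.sum_range_succ']
  simp only [Nat.sub_self, coeff_cycleSeries_zero, mul_zero, zero_mul, add_zero]
  refine Finset.sum_congr rfl fun k hk => ?_
  have hk := Finset.mem_range.1 hk
  have h1 : n + 1 - (k + 1) = (n - k - 1) + 1 := by omega
  have h2 : n - k = (n - k - 1) + 1 := by omega
  rw [h1, coeff_cycleSeries_succ, coeff_cycleSeries_succ, ← h2]

/-- The convolution in the cycle-sum recursion is the square of the series. The right side `X`
restores the value at length zero, which the series omits. -/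
lemma cycleSeries_quadratic :
    C x * cycleSeries x ^ 2 + (1 - X) * cycleSeries x = X := by
  ext n
  rw [sub_mul, one_mul, map_add, map_sub, coeff_C_mul]
  cases n with
  | zero => simp [coeff_cycleSeries_zero, pow_two, coeff_mul]
  | succ n =>
    rw [coeff_cycleSeries_sq, coeff_succ_X_mul, coeff_cycleSeries_succ, cycleSum_succ, coeff_X]
    cases n with
    | zero => simp [coeff_cycleSeries_zero, cycleSum_zero]
    | succ n => simp [coeff_cycleSeries_succ]

lemma cycleSum_three_term (m : ℕ) :
    x * ((m + 4) * cycleSum x (m + 4) + (2 * x - 1) * (2 * m + 5) * cycleSum x (m + 3) +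
      (m + 1) * cycleSum x (m + 2)) = 0 := by
  -- Completing the square in the quadratic equation makes `Y ^ 2` a polynomial.
  set Y : PowerSeries ℝ := C (2 * x) * cycleSeries x + 1 - X with hY
  set b : ℝ := 4 * x - 2 with hb
  have hYY : Y ^ 2 = 1 + C b * X + X ^ 2 := by
    have h := cycleSeries_quadratic x
    have h1 : Y ^ 2 = C (4 * x) * (C x * cycleSeries x ^ 2 + (1 - X) * cycleSeries x) +
        (1 - X) ^ 2 := by
      rw [hY, map_mul, map_mul]
      have h2 : (C (2 : ℝ)) = 2 := map_ofNat C 2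
      have h4 : (C (4 : ℝ)) = 4 := map_ofNat C 4
      rw [h2, h4]
      ring
    rw [h1, h, hb, map_sub, map_mul]
    have h2 : (C (2 : ℝ)) = 2 := map_ofNat C 2
    rw [h2]
    ring
  have hD : 2 * Y * d⁄dX ℝ Y = C b + 2 * X := by
    have h := congrArg (d⁄dX ℝ) hYY
    rw [pow_two, Derivation.leibniz] at h
    simp only [map_add, Derivation.leibniz, Derivation.map_one_eq_zero, smul_eq_mul, pow_two,
      PowerSeries.derivative_X, PowerSeries.derivative_C] at h
    linear_combination h
  -- Multiplying `hD` by `Y` and inserting `hYY` gives a linear differential equation with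
  -- polynomial coefficients, whose coefficients yield the recurrence.
  have hE : C 2 * d⁄dX ℝ Y + C (2 * b) * (X * d⁄dX ℝ Y) + C 2 * (X * (X * d⁄dX ℝ Y)) =
      C b * Y + C 2 * (X * Y) := by
    have h2 : (C (2 : ℝ)) = 2 := map_ofNat C 2
    rw [map_mul, h2]
    linear_combination Y * hD - 2 * d⁄dX ℝ Y * hYY
  have hc := congrArg (coeff (m + 3)) hE
  have hy : ∀ n, coeff (n + 2) Y = 2 * x * cycleSum x (n + 2) := by
    intro n
    rw [hY, map_sub, map_add, coeff_C_mul, coeff_cycleSeries_succ, coeff_X, coeff_one]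
    simp
  simp only [map_add, coeff_C_mul, coeff_succ_X_mul, PowerSeries.coeff_derivative, hy] at hc
  push_cast at hc
  rw [hb] at hc
  linear_combination hc / 4

lemma cycleSum_ne_zero_or (h0 : 0 < x) (h1 : x < 1) (n : ℕ) :
    cycleSum x (n + 1) ≠ 0 ∨ cycleSum x (n + 2) ≠ 0 := by
  have hv1 : cycleSum x 1 = 1 := by rw [cycleSum_succ, cycleSum_zero]; simp
  have hv2 : cycleSum x 2 = 1 - x := by rw [cycleSum_succ, hv1]; simp [hv1]
  induction n with
  | zero => left; rw [hv1]; exact one_ne_zero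
  | succ n ih =>
    by_contra! hcon
    obtain ⟨h2, h3⟩ := hcon
    cases n with
    | zero => rw [hv2] at h2; linarith
    | succ m =>
      have h4 := cycleSum_three_term x m
      rw [show m + 1 + 1 + 1 = m + 3 from rfl] at h2
      rw [show m + 1 + 1 + 2 = m + 4 from rfl] at h3
      rw [h2, h3] at h4
      -- Two consecutive zeros propagate downwards, contradicting the preceding pair.
      have h5 : cycleSum x (m + 2) = 0 := by
        have : x * ((m : ℝ) + 1) ≠ 0 := by positivity
        apply (mul_eq_zero.1 (_ : x * ((m : ℝ) + 1) * cycleSum x (m + 2) = 0)).resolve_left this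
        linear_combination h4
      rcases ih with h | h
      exacts [h h5, h h2]

end CycleSeries

/-! ### Catalan numbers and derangements -/

lemma catalan_eq_choose_div (l : ℕ) :
    (catalan l : ℚ) = (Nat.choose (2 * l) l : ℚ) / (l + 1) := by
  have h := succ_mul_catalan_eq_centralBinom l
  rw [Nat.centralBinom] at h
  rw [← h]
  push_cast
  field_simp

lemma catalan_le_factorial (l : ℕ) : catalan l ≤ Nat.factorial l := by
  induction l using Nat.strong_induction_on with
  | _ l ih =>
  cases l with
  | zero => simp
  | succ n =>
    rw [← sum_catalan_mul_catalan, Nat.factorial_succ]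
    calc ∑ k ∈ Finset.range (n + 1), catalan k * catalan (n - k)
        ≤ ∑ k ∈ Finset.range (n + 1), n.factorial := by
          refine Finset.sum_le_sum fun k hk => ?_
          have hk := Finset.mem_range.1 hk
          calc catalan k * catalan (n - k) ≤ k.factorial * (n - k).factorial :=
                Nat.mul_le_mul (ih _ hk) (ih _ (by omega))
            _ ≤ n.factorial := Nat.le_of_dvd n.factorial_pos
                (Nat.factorial_mul_factorial_dvd_factorial (by omega))
      _ = (n + 1) * n.factorial := by simp

lemma catalan_mul_catalan_le (a b : ℕ) : catalan a * catalan b ≤ catalan (a + b) := by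
  induction a using Nat.strong_induction_on with
  | _ a ih =>
  cases a with
  | zero => simp
  | succ n =>
    rw [← sum_catalan_mul_catalan, Finset.sum_mul, Nat.add_right_comm,
      ← sum_catalan_mul_catalan (n + b)]
    calc ∑ k ∈ Finset.range (n + 1), catalan k * catalan (n - k) * catalan b
        ≤ ∑ k ∈ Finset.range (n + 1), catalan k * catalan (n + b - k) := by
          refine Finset.sum_le_sum fun k hk => ?_
          have hk := Finset.mem_range.1 hk
          rw [mul_assoc]
          refine Nat.mul_le_mul le_rfl ((ih _ (by omega)).trans_eq ?_)
          congr 1; omega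
      _ ≤ _ := Finset.sum_le_sum_of_subset (by
          intro k; simp only [Finset.mem_range]; omega)

lemma catalanProd_le (σ : Perm (Fin t)) : catalanProd σ ≤ catalan σ.support.card := by
  induction σ using cycle_induction_on with
  | base_one => simp [catalanProd]
  | base_cycles σ hσ => simp [catalanProd, hσ.cycleFactorsFinset_eq_singleton]
  | induction_disjoint σ τ hd _ h2 h3 =>
    rw [hd.card_support_mul]
    refine le_trans ?_ (catalan_mul_catalan_le _ _)
    rw [catalanProd, prod_cycleFactorsFinset_mul hd]
    exact Nat.mul_le_mul h2 h3

lemma card_filter_card_eq (l : ℕ) :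
    (Finset.univ.filter fun Γ : Finset (Fin t) => Γ.card = l).card = Nat.choose t l := by
  have h : (Finset.univ.filter fun Γ : Finset (Fin t) => Γ.card = l) =
      Finset.powersetCard l Finset.univ := by
    ext Γ; simp [Finset.mem_powersetCard]
  rw [h, Finset.card_powersetCard, Finset.card_univ, Fintype.card_fin]

lemma card_filter_support_eq (Γ : Finset (Fin t)) :
    (Finset.univ.filter fun σ : Perm (Fin t) => σ.support = Γ).card =
      numDerangements Γ.card := by
  have h1 : numDerangements Γ.card =
      Fintype.card (derangements {x // x ∈ Γ}) := by
    rw [card_derangements_eq_numDerangements, Fintype.card_coe]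
  rw [h1, Fintype.card_congr (derangements.subtypeEquiv fun x => x ∈ Γ), ← Fintype.card_subtype]
  refine Fintype.card_congr (Equiv.subtypeEquivRight fun σ => ?_)
  simp only [Finset.ext_iff, mem_support, Function.mem_fixedPoints, Function.IsFixedPt]
  refine forall_congr' fun x => ?_
  tauto

lemma factorial_eq_sum (t : ℕ) :
    Nat.factorial t =
      ∑ l ∈ Finset.range (t + 1) \ {1}, Nat.choose t l * numDerangements l := by
  have h1 : Nat.factorial t = ∑ Γ : Finset (Fin t), numDerangements Γ.card := by
    have h2 := Finset.card_eq_sum_card_fiberwise (s := (Finset.univ : Finset (Perm (Fin t))))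
      (t := Finset.univ) (f := fun σ => σ.support) (fun _ _ => Finset.mem_univ _)
    rw [Finset.card_univ, Fintype.card_perm, Fintype.card_fin] at h2
    rw [h2]
    exact Finset.sum_congr rfl fun Γ _ => card_filter_support_eq Γ
  rw [h1, ← Finset.powerset_univ, Finset.sum_powerset_apply_card, Finset.card_univ,
    Fintype.card_fin]
  simp only [smul_eq_mul]
  symm
  refine Finset.sum_subset Finset.sdiff_subset fun l hl hl' => ?_
  have : l = 1 := by
    by_contra h
    exact hl' (by simp [h] at hl ⊢; exact hl)
  simp [this]

lemma numDerangements_eq_factorial_mul (l : ℕ) :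
    (numDerangements l : ℝ) =
      l.factorial * ∑ m ∈ Finset.range (l + 1), (-1 : ℝ) ^ m / m.factorial := by
  have h := congrArg (Int.cast : ℤ → ℝ) (numDerangements_sum l)
  push_cast at h
  rw [h, Finset.mul_sum]
  refine Finset.sum_congr rfl fun k hk => ?_
  have hk := Finset.mem_range.1 hk
  have h1 := Nat.factorial_mul_ascFactorial k (l - k)
  rw [Nat.add_sub_cancel' (by omega)] at h1
  have h2 : (k.factorial : ℝ) ≠ 0 := by positivity
  rw [← h1]
  push_cast
  field_simp

lemma numDerangements_eq_floor (l : ℕ) (hl : 1 ≤ l) :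
    (numDerangements l : ℤ) = ⌊(Nat.factorial l : ℝ) / Real.exp 1 + 1 / 2⌋ := by
  symm
  rw [Int.floor_eq_iff]
  push_cast
  -- The tail of the exponential series gives an error of at most `(l + 2) / (l + 1)²`, which is
  -- below `1/2` only from `l = 2` on.
  rcases Nat.lt_or_ge 1 l with h | h
  · have h1 := Real.exp_bound (x := -1) (by simp) (n := l + 1) (by omega)
    have h2 := numDerangements_eq_factorial_mul l
    set S := ∑ m ∈ Finset.range (l + 1), (-1 : ℝ) ^ m / m.factorial
    have hpos : (0 : ℝ) < l.factorial := by positivity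
    have h3 : (l.factorial : ℝ) / Real.exp 1 = l.factorial * Real.exp (-1) := by
      rw [Real.exp_neg]; rfl
    have h4 : |(l.factorial : ℝ) / Real.exp 1 - numDerangements l| < 1 / 2 := by
      rw [h3, h2, ← mul_sub, abs_mul, abs_of_pos hpos]
      refine (mul_le_mul_of_nonneg_left h1 hpos.le).trans_lt ?_
      rw [Nat.factorial_succ]
      have hl2 : (2 : ℝ) ≤ l := by exact_mod_cast h
      push_cast
      rw [abs_neg, abs_one, one_pow, one_mul]
      have h5 : (l.factorial : ℝ) * ((l + 1 + 1) / ((l + 1) * l.factorial * (l + 1))) =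
          (l + 2) / ((l + 1) * (l + 1)) := by
        field_simp
        ring
      rw [h5, div_lt_div_iff₀ (by positivity) (by norm_num)]
      nlinarith
    rw [abs_lt] at h4
    constructor <;> linarith [h4.1, h4.2]
  · obtain rfl : l = 1 := by omega
    have h1 := Real.exp_one_gt_two
    have h2 : 1 / Real.exp 1 < 1 / 2 := by
      rw [div_lt_div_iff₀ (by linarith) (by norm_num)]; linarith
    have h3 : 0 < 1 / Real.exp 1 := by positivity
    simp only [Nat.factorial_one, Nat.cast_one, numDerangements_one, Nat.cast_zero]
    constructor <;> linarith

/-! ### Monotone enumerations -/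

lemma exists_monotone_enumeration (t : ℕ) :
    ∃ e : Perm (Fin t) ≃ Fin (Nat.factorial t),
      ∀ π σ : Perm (Fin t), SubPerm π σ → e π ≤ e σ := by
  -- Sorting by size suffices, with ties broken arbitrarily: distinct permutations of equal size are
  -- incomparable.
  let f : Perm (Fin t) → ℕ ×ₗ Fin (Fintype.card (Perm (Fin t))) :=
    fun σ => toLex (permSize σ, Fintype.equivFin _ σ)
  have hf : Function.Injective f := by
    intro a b h
    have := congrArg (fun p => (ofLex p).2) h
    simpa [f] using this
  let _ : LinearOrder (Perm (Fin t)) := LinearOrder.lift' f hf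
  have hc : Fintype.card (Perm (Fin t)) = Nat.factorial t := by
    rw [Fintype.card_perm, Fintype.card_fin]
  refine ⟨(Fintype.orderIsoFinOfCardEq _ hc).symm.toEquiv, fun π σ h => ?_⟩
  refine (Fintype.orderIsoFinOfCardEq _ hc).symm.monotone ?_
  change f π ≤ f σ
  rcases h.permSize_le.lt_or_eq with h1 | h1
  · exact Prod.Lex.toLex_le_toLex.2 (Or.inl h1)
  · rw [h.eq_of_permSize_le h1.ge]

lemma phi_blockTriangular (e : Perm (Fin t) ≃ Fin (Nat.factorial t))
    (he : ∀ π σ : Perm (Fin t), SubPerm π σ → e π ≤ e σ) :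
    ((phi t).submatrix e.symm e.symm).BlockTriangular OrderDual.toDual := by
  intro i j hij
  rw [OrderDual.toDual_lt_toDual] at hij
  rw [Matrix.submatrix_apply, phi_apply, if_neg]
  intro h
  have := he _ _ h
  simp only [Equiv.apply_symm_apply] at this
  exact absurd hij (not_lt.2 this)

/-! ### Overlaps with permutation operators -/

lemma overlap_eq_sum {n : Type} [Fintype n] (X Y : Matrix n n ℂ) :
    overlap X Y = (∑ y, ∑ x, star (X x y) * Y x y) / (Fintype.card n : ℂ) := by
  simp [overlap, Matrix.trace, Matrix.mul_apply, Matrix.conjTranspose_apply]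

lemma overlap_conj {n : Type} [Fintype n] (X Y : Matrix n n ℂ) :
    overlap X Y = star (overlap Y X) := by
  simp only [overlap_eq_sum, star_div₀, star_sum, star_mul', star_star, star_natCast, mul_comm]

/-- The overlap as a linear functional of its second argument. -/
def overlapLin {n : Type} [Fintype n] (X : Matrix n n ℂ) : Matrix n n ℂ →ₗ[ℂ] ℂ where
  toFun := overlap X
  map_add' Y Z := by simp [overlap, mul_add, add_div]
  map_smul' c Y := by simp [overlap, mul_div_assoc]

lemma overlapLin_apply {n : Type} [Fintype n] (X Y : Matrix n n ℂ) :
    overlapLin X Y = overlap X Y := rfl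

lemma card_space : (Fintype.card (Fin t → Fin d) : ℂ) = (d : ℂ) ^ t := by simp

/-- Exchanging `a` with `y i` is an involution on pairs `(y, a)`. This lets one coordinate be summed
on its own. -/
lemma sum_sum_update {α β M : Type*} [Fintype α] [DecidableEq α] [Fintype β] [AddCommMonoid M]
    (i : α) (h : (α → β) → M) :
    ∑ y : α → β, ∑ a : β, h (Function.update y i a) = Fintype.card β • ∑ y, h y := by
  have h1 : ∑ y : α → β, ∑ a : β, h (Function.update y i a) = ∑ y : α → β, ∑ _a : β, h y := by
    rw [← Fintype.sum_prod_type', ← Fintype.sum_prod_type']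
    refine Finset.sum_bij' (fun p _ => (Function.update p.1 i p.2, p.1 i))
      (fun p _ => (Function.update p.1 i p.2, p.1 i)) ?_ ?_ ?_ ?_ ?_ <;> simp
  rw [h1]
  simp [Finset.sum_nsmul]

/-- The trace of `(⊗ P_k)† R_π`. -/
def stringTrace (P : Fin t → Op d) (π : Perm (Fin t)) : ℂ :=
  ∑ y : Fin t → Fin d, ∏ k, star (P k (y (π⁻¹ k)) (y k))

lemma overlap_tensorOp_permOp (P : Fin t → Op d) (π : Perm (Fin t)) :
    overlap (tensorOp P) (permOp d π) = stringTrace P π / (d : ℂ) ^ t := by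
  rw [overlap_eq_sum, card_space, stringTrace]
  congr 1
  refine Finset.sum_congr rfl fun y _ => ?_
  simp [permOp, tensorOp, mul_ite]

/-- The identity at `i` only equates two indices. After deletion the index at `i` is a free loop
worth `d`, the factor that the normalization of `N_π` absorbs. -/
lemma stringTrace_deletePoint {P : Fin t → Op d} {π : Perm (Fin t)} {i : Fin t} (hP : P i = 1)
    (hi : π i ≠ i) : stringTrace P (deletePoint π i) = d * stringTrace P π := by
  set π' := deletePoint π i with hπ'
  have hinv : ∀ k, π'⁻¹ k = π⁻¹ (swap i (π i) k) := by
    intro k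
    rw [hπ', deletePoint, mul_inv_rev, swap_inv, Perm.mul_apply]
  have hk0 : π⁻¹ i ≠ i := by
    rw [Ne, Perm.inv_eq_iff_eq]; exact fun h => hi h.symm
  set F : (Fin t → Fin d) → ℂ := fun y =>
    ∏ k ∈ Finset.univ.erase i, star (P k (y (π'⁻¹ k)) (y k)) with hF
  have hFu : ∀ y a, F (Function.update y i a) = F y := by
    intro y a
    refine Finset.prod_congr rfl fun k hk => ?_
    have hki : k ≠ i := Finset.ne_of_mem_erase hk
    have h1 : π'⁻¹ k ≠ i := by
      rw [Ne, Perm.inv_eq_iff_eq, hπ', deletePoint_apply_self]; exact hki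
    rw [Function.update_of_ne h1, Function.update_of_ne hki]
  have h1 : stringTrace P π' = ∑ y, F y := by
    refine Finset.sum_congr rfl fun y _ => ?_
    rw [← Finset.mul_prod_erase _ _ (Finset.mem_univ i)]
    have h2 : π'⁻¹ i = i := by rw [Perm.inv_eq_iff_eq, hπ', deletePoint_apply_self]
    rw [h2, hP, Matrix.one_apply_eq, star_one, one_mul]
  have h2 : stringTrace P π = ∑ y : Fin t → Fin d, if y (π⁻¹ i) = y i then F y else 0 := by
    refine Finset.sum_congr rfl fun y _ => ?_
    rw [← Finset.mul_prod_erase _ _ (Finset.mem_univ i), hP, Matrix.one_apply]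
    split_ifs with hy
    · rw [star_one, one_mul]
      refine Finset.prod_congr rfl fun k hk => ?_
      have hki : k ≠ i := Finset.ne_of_mem_erase hk
      rw [hinv]
      by_cases hk' : k = π i
      · rw [hk', swap_apply_right, show π⁻¹ (π i) = i from π.symm_apply_apply i, hy]
      · rw [swap_apply_of_ne_of_ne hki hk']
    · simp
  have h3 := sum_sum_update i (fun y : Fin t → Fin d => if y (π⁻¹ i) = y i then F y else 0)
  simp only [Function.update_self, Function.update_of_ne hk0, hFu, Finset.sum_ite_eq,
    Finset.mem_univ, if_true, Fintype.card_fin, nsmul_eq_mul] at h3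
  rw [h1, h2, h3]

lemma stringTrace_eq_zero (hd : 1 ≤ d) {P : Fin t → Op d} {π : Perm (Fin t)} {i : Fin t}
    (hP : overlap (P i) 1 = 0) (hi : π i = i) : stringTrace P π = 0 := by
  have hd' : (d : ℂ) ≠ 0 := by exact_mod_cast (by omega : d ≠ 0)
  have htr : ∑ a, star (P i a a) = 0 := by
    rw [overlap_eq_sum, Fintype.card_fin, div_eq_zero_iff, or_iff_left hd'] at hP
    rw [← hP]
    refine Finset.sum_congr rfl fun a _ => ?_
    simp [Matrix.one_apply]
  have hi' : π⁻¹ i = i := by rw [Perm.inv_eq_iff_eq, hi]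
  have h3 := sum_sum_update i (fun y : Fin t → Fin d => ∏ k, star (P k (y (π⁻¹ k)) (y k)))
  have h4 : ∀ (y : Fin t → Fin d) (a : Fin d),
      ∏ k, star (P k (Function.update y i a (π⁻¹ k)) (Function.update y i a k)) =
        star (P i a a) * ∏ k ∈ Finset.univ.erase i, star (P k (y (π⁻¹ k)) (y k)) := by
    intro y a
    rw [← Finset.mul_prod_erase _ _ (Finset.mem_univ i), hi', Function.update_self]
    congr 1
    refine Finset.prod_congr rfl fun k hk => ?_
    have hki : k ≠ i := Finset.ne_of_mem_erase hk
    have h1 : π⁻¹ k ≠ i := by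
      rw [Ne, Perm.inv_eq_iff_eq, hi]; exact hki
    rw [Function.update_of_ne h1, Function.update_of_ne hki]
  simp only [h4, ← Finset.sum_mul, htr, zero_mul, Finset.sum_const_zero, Fintype.card_fin,
    nsmul_eq_mul] at h3
  exact (mul_eq_zero.1 h3.symm).resolve_left hd'

lemma tensorOp_one : tensorOp (fun _ : Fin t => (1 : Op d)) = 1 := by
  ext x y
  simp only [tensorOp, Matrix.of_apply, Matrix.one_apply, Finset.prod_ite_zero, Finset.mem_univ,
    true_implies, Finset.prod_const_one, funext_iff]

lemma stringTrace_mul_pow (P : Fin t → Op d) (hP : ∀ k, P k = 1) (π : Perm (Fin t)) :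
    stringTrace P π * (d : ℂ) ^ permSize π = (d : ℂ) ^ t := by
  obtain ⟨n, hn⟩ : ∃ n, permSize π = n := ⟨_, rfl⟩
  induction n generalizing π with
  | zero =>
    rw [permSize_eq_zero_iff.1 hn]
    simp [stringTrace, hP]
  | succ n ih =>
    obtain ⟨a, ha⟩ : ∃ a, π a ≠ a := by
      by_contra! h'
      rw [show π = 1 from Equiv.ext h', permSize_one] at hn
      omega
    have h1 := permSize_deletePoint ha
    rw [← ih (deletePoint π a) (by omega), stringTrace_deletePoint (hP a) ha, ← h1, pow_succ]
    ring

lemma overlap_one_permOp (hd : 1 ≤ d) (σ : Perm (Fin t)) :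
    overlap (1 : TOp t d) (permOp d σ) = ((d : ℂ) ^ permSize σ)⁻¹ := by
  have hd' : (d : ℂ) ≠ 0 := by exact_mod_cast (by omega : d ≠ 0)
  rw [← tensorOp_one, overlap_tensorOp_permOp, ← stringTrace_mul_pow _ (fun _ => rfl) σ]
  have h1 := stringTrace_mul_pow (fun _ : Fin t => (1 : Op d)) (fun _ => rfl) σ
  have h2 : stringTrace (fun _ : Fin t => (1 : Op d)) σ ≠ 0 := by
    intro h
    rw [h, zero_mul] at h1
    exact pow_ne_zero _ hd' h1.symm
  field_simp

lemma normPerm_eq (hd : 1 ≤ d) (σ : Perm (Fin t)) :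
    normPerm d σ = (d : ℂ) ^ permSize σ • permOp d σ := by
  rw [normPerm, overlap_one_permOp hd, inv_inv]

lemma conjTranspose_permOp_mul (σ π : Perm (Fin t)) :
    (permOp d σ)ᴴ * permOp d π = permOp d (σ⁻¹ * π) := by
  ext x y
  rw [Matrix.mul_apply, Finset.sum_eq_single (y ∘ ⇑π⁻¹)]
  rotate_left
  · intro z _ hz
    simp only [permOp, Matrix.of_apply, if_neg hz, mul_zero]
  · simp
  simp only [Matrix.conjTranspose_apply, permOp, Matrix.of_apply, if_true, mul_one,
    apply_ite star, star_one, star_zero]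
  refine if_congr ?_ rfl rfl
  simp only [funext_iff, Function.comp_apply, mul_inv_rev, inv_inv, Perm.mul_apply]
  constructor
  · intro h k
    have := h (σ k)
    simpa using this.symm
  · intro h k
    have := h (σ⁻¹ k)
    simpa using this.symm

lemma overlap_permOp (σ π : Perm (Fin t)) :
    overlap (permOp d σ) (permOp d π) = overlap 1 (permOp d (σ⁻¹ * π)) := by
  rw [overlap, conjTranspose_permOp_mul, overlap, Matrix.conjTranspose_one, one_mul]

lemma overlap_normPerm (hd : 1 ≤ d) (σ π : Perm (Fin t)) :
    overlap (normPerm d σ) (normPerm d π) =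
      (d : ℂ) ^ permSize σ * (d : ℂ) ^ permSize π * ((d : ℂ) ^ permSize (σ⁻¹ * π))⁻¹ := by
  rw [normPerm_eq hd, normPerm_eq hd, ← overlapLin_apply, map_smul, overlapLin_apply, overlap_conj,
    ← overlapLin_apply, map_smul, overlapLin_apply, overlap_permOp, overlap_one_permOp hd]
  have h : permSize (π⁻¹ * σ) = permSize (σ⁻¹ * π) := by
    rw [← permSize_inv]; simp
  simp [h]
  ring

/-! ### The change of basis -/

lemma locPerm_eq (σ : Perm (Fin t)) :
    locPerm d σ = ∑ π ∈ subPerms σ, phi t σ π • normPerm d π := by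
  simp [locPerm, Int.cast_smul_eq_zsmul]

lemma normPerm_eq_sum_locPerm (σ : Perm (Fin t)) :
    normPerm d σ = ∑ π ∈ subPerms σ, locPerm d π :=
  (mobius_inversion (normPerm d) (locPerm d)).2 locPerm_eq σ

lemma normPerm_eq_sum_iff (L : Perm (Fin t) → TOp t d) :
    (∀ σ, normPerm d σ = ∑ π ∈ subPerms σ, L π) ↔
      ∀ σ, L σ = ∑ π ∈ subPerms σ, (phi t σ π : ℂ) • normPerm d π := by
  simp only [Int.cast_smul_eq_zsmul]
  exact mobius_inversion (normPerm d) L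

lemma span_locPerm (t d : ℕ) :
    Submodule.span ℂ (Set.range fun σ : Perm (Fin t) => locPerm d σ) =
      Submodule.span ℂ (Set.range fun σ : Perm (Fin t) => normPerm d σ) := by
  refine le_antisymm (Submodule.span_le.2 ?_) (Submodule.span_le.2 ?_)
  · rintro _ ⟨σ, rfl⟩
    exact Submodule.sum_mem _ fun π _ =>
      Submodule.smul_mem _ _ (Submodule.subset_span ⟨π, rfl⟩)
  · rintro _ ⟨σ, rfl⟩
    simp only [SetLike.mem_coe]
    rw [normPerm_eq_sum_locPerm]
    exact Submodule.sum_mem _ fun π _ => Submodule.subset_span ⟨π, rfl⟩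

lemma linearIndependent_permOp (h : t ≤ d) :
    LinearIndependent ℂ (fun σ : Perm (Fin t) => permOp d σ) := by
  rw [Fintype.linearIndependent_iff]
  intro g hg σ
  -- A basis vector with pairwise distinct entries, available since `t ≤ d`, is moved to different
  -- basis vectors by different permutations.
  have h1 := congrFun (congrFun hg ((Fin.castLE h) ∘ ⇑σ⁻¹)) (Fin.castLE h)
  rw [Matrix.sum_apply, Finset.sum_eq_single σ] at h1
  · simpa [permOp] using h1
  · intro π _ hπ
    have : ¬ (Fin.castLE h) ∘ ⇑σ⁻¹ = (Fin.castLE h) ∘ ⇑π⁻¹ := by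
      intro h2
      refine hπ (inv_injective (Equiv.ext fun k => ?_))
      exact (Fin.castLE_injective h (congrFun h2 k)).symm
    simp only [Matrix.smul_apply, permOp, Matrix.of_apply, if_neg this, smul_zero]
  · simp

lemma linearIndependent_normPerm (hd : 1 ≤ d) (h : t ≤ d) :
    LinearIndependent ℂ (fun σ : Perm (Fin t) => normPerm d σ) := by
  have hd' : (d : ℂ) ≠ 0 := by exact_mod_cast (by omega : d ≠ 0)
  have h1 := (linearIndependent_permOp h).units_smul
    (fun σ => (Units.mk0 ((d : ℂ) ^ permSize σ) (pow_ne_zero _ hd')))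
  convert h1 using 1
  funext σ
  rw [normPerm_eq hd]
  rfl

lemma linearIndependent_locPerm (hd : 1 ≤ d) (h : t ≤ d) :
    LinearIndependent ℂ (fun σ : Perm (Fin t) => locPerm d σ) := by
  have h1 := linearIndependent_normPerm hd h
  rw [linearIndependent_iff_card_eq_finrank_span] at h1 ⊢
  rw [h1, Set.finrank, Set.finrank, span_locPerm]

/-! ### Localization -/

/-- A functional that does not see the point `i` annihilates the localized permutations that
move `i`. -/
lemma map_locPerm_eq_zero (ψ : TOp t d →ₗ[ℂ] ℂ) {i : Fin t}
    (hψ : ∀ π, ψ (normPerm d π) = ψ (normPerm d (deletePoint π i))) {σ : Perm (Fin t)}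
    (hσ : σ i ≠ i) : ψ (locPerm d σ) = 0 := by
  -- Both `ψ (L_σ)` and its truncation to `σ` fixing `i` sum to `ψ (N_σ)` over sub-permutations,
  -- because those fixing `i` are the ones below `σ` with `i` deleted. Uniqueness of inversion
  -- identifies the two families.
  have h1 := (mobius_inversion (fun σ => ψ (normPerm d σ)) (fun σ => ψ (locPerm d σ))).1
    (fun σ => by rw [normPerm_eq_sum_locPerm, map_sum])
  have h2 := (mobius_inversion (fun σ => ψ (normPerm d σ))
    (fun σ => if σ i = i then ψ (locPerm d σ) else 0)).1 (fun σ => by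
      rw [hψ, normPerm_eq_sum_locPerm, map_sum, ← Finset.sum_filter, filter_subPerms_apply_self])
  have h3 := (h1 σ).trans (h2 σ).symm
  simpa [hσ] using h3

lemma overlap_tensorOp_normPerm (hd : 1 ≤ d) (P : Fin t → Op d) (π : Perm (Fin t)) :
    overlap (tensorOp P) (normPerm d π) =
      (d : ℂ) ^ permSize π * (stringTrace P π / (d : ℂ) ^ t) := by
  rw [normPerm_eq hd, ← overlapLin_apply, map_smul, overlapLin_apply, overlap_tensorOp_permOp,
    smul_eq_mul]

lemma stringSupport_eq (hd : 1 ≤ d) {B : Finset (Op d)} (hB : IsOperatorBasis B)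
    {P : Fin t → Op d} (hP : ∀ i, P i ∈ B) {σ : Perm (Fin t)}
    (h : overlap (tensorOp P) (locPerm d σ) ≠ 0) : stringSupport P = σ.support := by
  ext i
  rw [stringSupport, Finset.mem_filter, mem_support]
  simp only [Finset.mem_univ, true_and]
  constructor
  · intro hi hσ
    apply h
    rw [← overlapLin_apply, locPerm, map_sum]
    refine Finset.sum_eq_zero fun π hπ => ?_
    have hπi : π i = i := (mem_subPerms.1 hπ).apply_eq hσ
    rw [map_smul, overlapLin_apply, overlap_tensorOp_normPerm hd,
      stringTrace_eq_zero hd (hB.overlap_ne _ (hP i) _ hB.one_mem hi) hπi]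
    simp
  · intro hσ hi
    apply h
    rw [← overlapLin_apply]
    refine map_locPerm_eq_zero _ (fun π => ?_) hσ
    rw [overlapLin_apply, overlapLin_apply, overlap_tensorOp_normPerm hd,
      overlap_tensorOp_normPerm hd]
    by_cases hπ : π i = i
    · rw [deletePoint_of_apply_eq hπ]
    · rw [stringTrace_deletePoint hi hπ, ← permSize_deletePoint hπ, pow_succ]
      ring

/-- Deleting a moved point `i` lowers both `|π|` and `|ρ⁻¹π|` by one, and the two powers of `d`
cancel. -/
lemma overlap_normPerm_deletePoint (hd : 1 ≤ d) {ρ : Perm (Fin t)} {i : Fin t} (hρ : ρ i = i)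
    (π : Perm (Fin t)) : overlap (normPerm d ρ) (normPerm d π) =
      overlap (normPerm d ρ) (normPerm d (deletePoint π i)) := by
  by_cases hπ : π i = i
  · rw [deletePoint_of_apply_eq hπ]
  have hd' : (d : ℂ) ≠ 0 := by exact_mod_cast (by omega : d ≠ 0)
  have hρ' : ρ⁻¹ i = i := by rw [Perm.inv_eq_iff_eq, hρ]
  have h1 : ρ⁻¹ * deletePoint π i = deletePoint (ρ⁻¹ * π) i := by
    rw [deletePoint, deletePoint, ← mul_assoc, Equiv.mul_swap_eq_swap_mul, hρ', mul_assoc,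
      Perm.mul_apply]
  have h2 : (ρ⁻¹ * π) i ≠ i := by
    rw [Perm.mul_apply, Ne, Perm.inv_eq_iff_eq, hρ]; exact hπ
  rw [overlap_normPerm hd, overlap_normPerm hd, h1, ← permSize_deletePoint hπ,
    ← permSize_deletePoint h2, pow_succ, pow_succ]
  field_simp

lemma overlap_locPerm_of_fixed (hd : 1 ≤ d) {σ π : Perm (Fin t)} {i : Fin t} (hσ : σ i = i)
    (hπ : π i ≠ i) : overlap (locPerm d σ) (locPerm d π) = 0 := by
  rw [overlap_conj, ← overlapLin_apply, locPerm.eq_def d σ, map_sum, Finset.sum_eq_zero, star_zero]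
  intro ρ hρ
  have hρi : ρ i = i := (mem_subPerms.1 hρ).apply_eq hσ
  rw [map_smul, overlapLin_apply, overlap_conj, ← overlapLin_apply,
    map_locPerm_eq_zero _ (fun κ => overlap_normPerm_deletePoint hd hρi κ) hπ]
  simp

lemma overlap_locPerm_eq_zero (hd : 1 ≤ d) {σ π : Perm (Fin t)} (h : σ.support ≠ π.support) :
    overlap (locPerm d σ) (locPerm d π) = 0 := by
  obtain ⟨i, hi⟩ : ∃ i, ¬ (i ∈ σ.support ↔ i ∈ π.support) := by
    by_contra! h'
    exact h (Finset.ext h')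
  rw [mem_support, mem_support] at hi
  by_cases h1 : σ i = i
  · exact overlap_locPerm_of_fixed hd h1 (by tauto)
  · rw [overlap_conj, overlap_locPerm_of_fixed hd (i := i) (by tauto) h1, star_zero]

lemma locGram_eq_blockDiagonal (hd : 1 ≤ d) :
    Matrix.reindex (Equiv.sigmaFiberEquiv fun σ : Perm (Fin t) => σ.support).symm
      (Equiv.sigmaFiberEquiv fun σ : Perm (Fin t) => σ.support).symm (locGram t d) =
        Matrix.blockDiagonal' (locGramBlock t d) := by
  ext ⟨Γ, σ, hσ⟩ ⟨Δ, π, hπ⟩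
  by_cases h : Γ = Δ
  · subst h
    rw [Matrix.blockDiagonal'_apply_eq]
    rfl
  · rw [Matrix.blockDiagonal'_apply_ne _ _ _ h]
    refine overlap_locPerm_eq_zero hd ?_
    change σ.support ≠ π.support
    rwa [hσ, hπ]

/-! ### The bound on the overlaps -/

/-- Catalan numbers increase, so `|μ(κ)| ≤ c(κ)`; and `c` counts sub-permutations, hence is monotone
for inclusion. -/
lemma abs_mobius_le {κ σ : Perm (Fin t)} (h : SubPerm κ σ) : |mobius κ| ≤ (catalanProd σ : ℤ) := by
  have h1 : |mobius κ| ≤ (catalanProd κ : ℤ) := by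
    rw [mobius, catalanProd, Finset.abs_prod, Nat.cast_prod]
    refine Finset.prod_le_prod (fun _ _ => abs_nonneg _) fun c hc => ?_
    rw [abs_mul, abs_pow, abs_neg, abs_one, one_pow, one_mul, Nat.abs_cast,
      ← permSize_add_one_of_isCycle (mem_cycleFactorsFinset_iff.1 hc).1]
    have := catalan_mul_catalan_le (permSize c) 1
    rw [catalan_one, mul_one] at this
    exact_mod_cast this
  refine h1.trans ?_
  rw [← card_subPerms, ← card_subPerms]
  exact_mod_cast Finset.card_le_card fun π hπ => mem_subPerms.2 ((mem_subPerms.1 hπ).trans h)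

lemma norm_phi_le {π σ : Perm (Fin t)} (h : SubPerm π σ) :
    ‖(phi t σ π : ℂ)‖ ≤ catalanProd σ := by
  rw [phi_apply, if_pos h, Complex.norm_intCast]
  exact_mod_cast abs_mobius_le (subPerm_inv_mul_iff.2 h)

lemma norm_map_locPerm_le {ψ : TOp t d →ₗ[ℂ] ℂ} {σ : Perm (Fin t)} {C : ℝ}
    (h : ∀ π, SubPerm π σ → ‖ψ (normPerm d π)‖ ≤ C) :
    ‖ψ (locPerm d σ)‖ ≤ (catalanProd σ : ℝ) ^ 2 * C := by
  rw [locPerm, map_sum]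
  refine (norm_sum_le _ _).trans ?_
  calc ∑ π ∈ subPerms σ, ‖ψ ((phi t σ π : ℂ) • normPerm d π)‖
      ≤ ∑ _π ∈ subPerms σ, (catalanProd σ : ℝ) * C := by
        refine Finset.sum_le_sum fun π hπ => ?_
        rw [map_smul, smul_eq_mul, norm_mul]
        exact mul_le_mul (norm_phi_le (mem_subPerms.1 hπ)) (h π (mem_subPerms.1 hπ))
          (norm_nonneg _) (Nat.cast_nonneg _)
    _ = (catalanProd σ : ℝ) ^ 2 * C := by
        rw [Finset.sum_const, card_subPerms, nsmul_eq_mul]; ring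

lemma norm_overlap_locPerm_le (hd : 1 ≤ d) (σ π : Perm (Fin t)) :
    ‖overlap (locPerm d σ) (locPerm d π)‖ ≤
      (catalanProd σ : ℝ) ^ 2 * (catalanProd π : ℝ) ^ 2 * (d : ℝ) ^ (permSize σ + permSize π) := by
  have hd1 : (1 : ℝ) ≤ d := by exact_mod_cast hd
  have h1 : ∀ a b : Perm (Fin t), SubPerm a σ → SubPerm b π →
      ‖overlap (normPerm d b) (normPerm d a)‖ ≤ (d : ℝ) ^ (permSize σ + permSize π) := by
    intro a b ha hb
    rw [overlap_normPerm hd, norm_mul, norm_mul, norm_inv, norm_pow, norm_pow, norm_pow,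
      Complex.norm_natCast, pow_add, mul_comm ((d : ℝ) ^ permSize b)]
    calc (d : ℝ) ^ permSize a * (d : ℝ) ^ permSize b * ((d : ℝ) ^ permSize (b⁻¹ * a))⁻¹
        ≤ (d : ℝ) ^ permSize a * (d : ℝ) ^ permSize b * 1 := by
          gcongr
          exact inv_le_one_of_one_le₀ (one_le_pow₀ hd1)
      _ ≤ (d : ℝ) ^ permSize σ * (d : ℝ) ^ permSize π := by
          rw [mul_one]
          gcongr
          exacts [ha.permSize_le, hb.permSize_le]
  have h2 : ∀ b, SubPerm b π → ‖overlap (locPerm d σ) (normPerm d b)‖ ≤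
      (catalanProd σ : ℝ) ^ 2 * (d : ℝ) ^ (permSize σ + permSize π) := by
    intro b hb
    rw [overlap_conj, norm_star]
    exact norm_map_locPerm_le (ψ := overlapLin (normPerm d b)) fun a ha => h1 a b ha hb
  have h3 := norm_map_locPerm_le (ψ := overlapLin (locPerm d σ)) h2
  rw [overlapLin_apply] at h3
  linarith

/-! ### Localized permutations do not vanish -/

section Nonvanishing

open Classical in
/-- The weight `μ(κ) x^{|κ|}`, restricted to the permutations that fix `S` pointwise. -/
def fixingWeight (x : ℝ) (S : Set (Fin t)) (κ : Perm (Fin t)) : ℝ :=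
  if ∀ s ∈ S, κ s = s then mobiusWeight x κ else 0

lemma fixingWeight_mul (x : ℝ) (S : Set (Fin t)) {a b : Perm (Fin t)} (h : a.Disjoint b) :
    fixingWeight x S (a * b) = fixingWeight x S a * fixingWeight x S b := by
  have h1 : (∀ s ∈ S, (a * b) s = s) ↔ (∀ s ∈ S, a s = s) ∧ ∀ s ∈ S, b s = s := by
    simp only [← forall_and, h.mul_apply_eq_iff]
  unfold fixingWeight
  rw [mobiusWeight_mul x h]
  by_cases h2 : ∀ s ∈ S, a s = s
  · by_cases h3 : ∀ s ∈ S, b s = s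
    · rw [if_pos h2, if_pos h3, if_pos (h1.2 ⟨h2, h3⟩)]
    · rw [if_neg h3, if_neg fun h4 => h3 (h1.1 h4).2, mul_zero]
  · rw [if_neg h2, if_neg fun h4 => h2 (h1.1 h4).1, zero_mul]

lemma sum_fixingWeight (x : ℝ) (S : Set (Fin t)) (σ : Perm (Fin t)) :
    ∑ κ ∈ subPerms σ, fixingWeight x S κ =
      ∏ c ∈ σ.cycleFactorsFinset, ∑ κ ∈ subPerms c, fixingWeight x S κ :=
  eq_prod_cycleFactorsFinset (f := fun σ => ∑ κ ∈ subPerms σ, fixingWeight x S κ)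
    (by simp [subPerms_one, fixingWeight, mobiusWeight])
    (fun _ _ h => sum_subPerms_mul_of_multiplicative h fun _ _ h' => fixingWeight_mul x S h') σ

lemma sum_fixingWeight_of_disjoint (x : ℝ) {S : Set (Fin t)} {c : Perm (Fin t)}
    (h : ∀ s ∈ S, c s = s) : ∑ κ ∈ subPerms c, fixingWeight x S κ = charSum x c := by
  refine Finset.sum_congr rfl fun κ hκ => ?_
  rw [fixingWeight, if_pos fun s hs => (mem_subPerms.1 hκ).apply_eq (h s hs)]

lemma sum_fixingWeight_of_single (x : ℝ) {S : Set (Fin t)} {c : Perm (Fin t)} {r : Fin t}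
    (hr : r ∈ S) (h : ∀ s ∈ S, c s ≠ s → s = r) :
    ∑ κ ∈ subPerms c, fixingWeight x S κ = charSum x (deletePoint c r) := by
  rw [charSum, ← filter_subPerms_apply_self, Finset.sum_filter]
  refine Finset.sum_congr rfl fun κ hκ => ?_
  rw [fixingWeight]
  by_cases h1 : κ r = r
  · rw [if_pos h1, if_pos]
    intro s hs
    by_cases hs' : c s = s
    · exact (mem_subPerms.1 hκ).apply_eq hs'
    · rw [h s hs hs', h1]
  · rw [if_neg h1, if_neg fun h2 => h1 (h2 r hr)]

/-- A set that meets every cycle of `σ` at most once, for which the restricted sum is nonzero. -/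
lemma exists_fixing_set {x : ℝ} (h0 : 0 < x) (h1 : x < 1) (σ : Perm (Fin t)) :
    ∃ S : Set (Fin t), (∀ s ∈ S, ∀ s' ∈ S, σ.SameCycle s s' → s = s') ∧
      ∑ κ ∈ subPerms σ, fixingWeight x S κ ≠ 0 := by
  have hex : ∀ c ∈ σ.cycleFactorsFinset, ∃ r, r ∈ c.support := by
    intro c hc
    obtain ⟨r, hr, -⟩ := (mem_cycleFactorsFinset_iff.1 hc).1
    exact ⟨r, mem_support.2 hr⟩
  choose rep hrep using hex
  -- One point is marked in exactly those cycles whose unrestricted sum vanishes; fixing it passes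
  -- to the next shorter cycle sum.
  let S : Set (Fin t) := {s | ∃ (c : Perm (Fin t)) (hc : c ∈ σ.cycleFactorsFinset),
    cycleSum x c.support.card = 0 ∧ rep c hc = s}
  refine ⟨S, ?_, ?_⟩
  · rintro _ ⟨c, hc, -, rfl⟩ _ ⟨c', hc', -, rfl⟩ h
    have e1 := cycle_is_cycleOf (hrep c hc) hc
    have e2 := cycle_is_cycleOf (hrep c' hc') hc'
    have e3 : c = c' := by rw [e1, e2, h.cycleOf_eq]
    subst e3
    rfl
  · rw [sum_fixingWeight]
    refine Finset.prod_ne_zero_iff.2 fun c hc => ?_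
    have hcyc := (mem_cycleFactorsFinset_iff.1 hc).1
    have key : ∀ s ∈ S, c s ≠ s → cycleSum x c.support.card = 0 ∧ s = rep c hc := by
      rintro _ ⟨c', hc', h', rfl⟩ hs
      have e1 := cycle_is_cycleOf (mem_support.2 hs) hc
      have e2 := cycle_is_cycleOf (hrep c' hc') hc'
      have e3 : c = c' := by rw [e1, ← e2]
      subst e3
      exact ⟨h', rfl⟩
    by_cases hz : cycleSum x c.support.card = 0
    · rw [sum_fixingWeight_of_single x (S := S) (r := rep c hc) ⟨c, hc, hz, rfl⟩
        (fun s hs hs' => (key s hs hs').2),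
        charSum_deletePoint_of_isCycle x hcyc (mem_support.1 (hrep c hc))]
      obtain ⟨n, hn⟩ := Nat.exists_eq_add_of_le' hcyc.two_le_card_support
      rw [hn] at hz ⊢
      exact (cycleSum_ne_zero_or x h0 h1 n).resolve_right (by simpa using hz)
    · rw [sum_fixingWeight_of_disjoint x, charSum_of_isCycle x hcyc]
      · exact hz
      · intro s hs
        by_contra hs'
        exact hz (key s hs hs').1

/-- The complement `π⁻¹σ` moves points within cycles of `σ`, each with at most one marked point, so
it preserves the two-coloring `y` only by fixing every marked point. -/
lemma comp_inv_eq_comp_inv_iff {σ π : Perm (Fin t)} (h : SubPerm π σ) {S : Set (Fin t)}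
    (hS : ∀ s ∈ S, ∀ s' ∈ S, σ.SameCycle s s' → s = s') {y : Fin t → Fin d} {a : Fin d}
    (hy : ∀ k, y k = a ↔ k ∈ S) (hy2 : ∀ k l, k ∉ S → l ∉ S → y k = y l) :
    y ∘ ⇑σ⁻¹ = y ∘ ⇑π⁻¹ ↔ ∀ s ∈ S, (π⁻¹ * σ) s = s := by
  have hκ := subPerm_inv_mul_iff.2 h
  have h1 : y ∘ ⇑σ⁻¹ = y ∘ ⇑π⁻¹ ↔ ∀ k, y k = y ((π⁻¹ * σ) k) := by
    simp only [funext_iff, Function.comp_apply, Perm.mul_apply]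
    constructor
    · intro h k
      have := h (σ k)
      rwa [show σ⁻¹ (σ k) = k from σ.symm_apply_apply k] at this
    · intro h k
      have := h (σ⁻¹ k)
      rwa [show σ (σ⁻¹ k) = k from σ.apply_symm_apply k] at this
  rw [h1]
  generalize π⁻¹ * σ = κ at hκ ⊢
  constructor
  · intro h2 s hs
    have h3 : κ s ∈ S := by rw [← hy, ← h2, hy]; exact hs
    exact (hS s hs _ h3 (hκ.sameCycle_apply s)).symm
  · intro h2 k
    by_cases hk : k ∈ S
    · rw [h2 k hk]
    · refine hy2 _ _ hk fun h3 => hk ?_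
      have h4 := κ.injective (h2 _ h3)
      rwa [h4] at h3

lemma sum_subPerms_inv_mul {M : Type*} [AddCommMonoid M] (σ : Perm (Fin t))
    (f : Perm (Fin t) → M) :
    ∑ π ∈ subPerms σ, f (π⁻¹ * σ) = ∑ κ ∈ subPerms σ, f κ := by
  refine Finset.sum_bij' (fun π _ => π⁻¹ * σ) (fun κ _ => σ * κ⁻¹) ?_ ?_ ?_ ?_ ?_
  · intro π hπ
    exact mem_subPerms.2 (subPerm_inv_mul_iff.2 (mem_subPerms.1 hπ))
  · intro κ hκ
    refine mem_subPerms.2 (subPerm_inv_mul_iff.1 ?_)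
    simpa [mul_assoc] using mem_subPerms.1 hκ
  · intro π _
    simp
  · intro κ _
    simp
  · intro π _
    rfl

lemma locPerm_ne_zero_of_two_le (hd : 2 ≤ d) (σ : Perm (Fin t)) : locPerm d σ ≠ 0 := by
  classical
  have hd1 : 1 ≤ d := by omega
  have hdR : (2 : ℝ) ≤ d := by exact_mod_cast hd
  have hd0 : (d : ℝ) ≠ 0 := by linarith
  obtain ⟨S, hS, hne⟩ := exists_fixing_set (x := (d : ℝ)⁻¹) (by positivity)
    (inv_lt_one_of_one_lt₀ (by linarith)) σ
  let y : Fin t → Fin d := fun k => if k ∈ S then ⟨1, by omega⟩ else ⟨0, by omega⟩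
  have hy : ∀ k, y k = ⟨1, by omega⟩ ↔ k ∈ S := by
    intro k
    by_cases hk : k ∈ S <;> simp [y, hk]
  have hy2 : ∀ k l, k ∉ S → l ∉ S → y k = y l := by
    intro k l hk hl
    simp [y, hk, hl]
  intro hzero
  apply hne
  -- The entry receives `μ(π⁻¹σ) d^|π|` from each `π` acting on `y` as `σ` does, and `|π| = |σ| -
  -- |π⁻¹σ|` turns this into the weight at `x = 1/d`.
  have h1 : locPerm d σ (y ∘ ⇑σ⁻¹) y =
      (((d : ℝ) ^ permSize σ * ∑ κ ∈ subPerms σ, fixingWeight (d : ℝ)⁻¹ S κ : ℝ) : ℂ) := by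
    rw [locPerm, Matrix.sum_apply, ← sum_subPerms_inv_mul σ (fixingWeight (d : ℝ)⁻¹ S),
      Finset.mul_sum, Complex.ofReal_sum]
    refine Finset.sum_congr rfl fun π hπ => ?_
    have hπ' := mem_subPerms.1 hπ
    rw [normPerm_eq hd1, Matrix.smul_apply, Matrix.smul_apply, phi_apply, if_pos hπ', permOp,
      Matrix.of_apply, fixingWeight]
    simp only [← comp_inv_eq_comp_inv_iff hπ' hS hy hy2]
    split_ifs with h2
    · have h3 : permSize σ = permSize π + permSize (π⁻¹ * σ) := hπ'.symm
      rw [mobiusWeight, h3, pow_add]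
      push_cast
      have hdC : (d : ℂ) ≠ 0 := by exact_mod_cast hd0
      rw [inv_pow, smul_eq_mul, smul_eq_mul]
      field_simp
    · simp
  rw [hzero, Matrix.zero_apply] at h1
  have h2 := Complex.ofReal_eq_zero.1 h1.symm
  exact (mul_eq_zero.1 h2).resolve_left (pow_ne_zero _ hd0)

lemma locPerm_one_ne_zero (hd : 1 ≤ d) : locPerm d (1 : Perm (Fin t)) ≠ 0 := by
  intro h
  rw [locPerm, subPerms_one, Finset.sum_singleton, phi_self, normPerm_eq hd, permSize_one,
    pow_zero, one_smul, Int.cast_one, one_smul] at h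
  have h1 := congrFun (congrFun h fun _ => ⟨0, by omega⟩) fun _ => ⟨0, by omega⟩
  simp [permOp] at h1

end Nonvanishing

/-! ### Operator strings span -/

/-- The pairing of a tensor product operator with the entrywise conjugate of `X`. -/
def stringPairing (X : TOp t d) : MultilinearMap ℂ (fun _ : Fin t => Op d) ℂ :=
  ∑ y : Fin t → Fin d, ∑ x : Fin t → Fin d, star (X x y) •
    (MultilinearMap.mkPiAlgebra ℂ (Fin t) ℂ).compLinearMap
      fun i => Matrix.entryLinearMap ℂ ℂ (x i) (y i)

lemma stringPairing_apply (X : TOp t d) (P : Fin t → Op d) :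
    stringPairing X P = ∑ y, ∑ x, star (X x y) * tensorOp P x y := by
  simp [stringPairing, tensorOp]

lemma overlap_tensorOp (P : Fin t → Op d) (X : TOp t d) :
    overlap (tensorOp P) X = star (stringPairing X P) / (d : ℂ) ^ t := by
  rw [overlap_conj, overlap_eq_sum, card_space, stringPairing_apply, star_div₀]
  simp

/-- A multilinear form vanishing on all tuples from a spanning set vanishes identically, and on
matrix units the pairing reads off the conjugated entries of `X`. -/
lemma exists_overlap_ne_zero (hd : 1 ≤ d) {B : Finset (Op d)} (hB : IsOperatorBasis B)
    {X : TOp t d} (hX : X ≠ 0) :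
    ∃ P : Fin t → Op d, (∀ i, P i ∈ B) ∧ overlap (tensorOp P) X ≠ 0 := by
  classical
  by_contra! h
  have hd' : (d : ℂ) ≠ 0 := by exact_mod_cast (by omega : d ≠ 0)
  have h1 : ∀ P : Fin t → Op d, (∀ i, P i ∈ B) → stringPairing X P = 0 := by
    intro P hP
    have h2 := h P hP
    rw [overlap_tensorOp, div_eq_zero_iff, or_iff_left (pow_ne_zero _ hd')] at h2
    exact star_eq_zero.1 h2
  have h2 : ∀ P : Fin t → Op d, stringPairing X P = 0 := by
    intro P
    have hP : ∀ i, ∃ c : Op d → ℂ, ∑ b ∈ B, c b • b = P i := by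
      intro i
      have h3 : P i ∈ Submodule.span ℂ (B : Set (Op d)) := by rw [hB.span_eq_top]; trivial
      obtain ⟨c, -, hc⟩ := Submodule.mem_span_finset.1 h3
      exact ⟨c, hc⟩
    choose c hc using hP
    rw [← funext hc, MultilinearMap.map_sum_finset]
    refine Finset.sum_eq_zero fun r hr => ?_
    rw [MultilinearMap.map_smul_univ, h1 _ fun i => Fintype.mem_piFinset.1 hr i, smul_zero]
  apply hX
  ext x y
  have h3 := h2 fun i => Matrix.single (x i) (y i) 1
  have h4 : ∀ x' y', tensorOp (fun i => Matrix.single (x i) (y i) (1 : ℂ)) x' y' =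
      if x = x' ∧ y = y' then 1 else 0 := by
    intro x' y'
    simp only [tensorOp, Matrix.of_apply, Matrix.single_apply, Finset.prod_ite_zero,
      Finset.mem_univ, true_implies, Finset.prod_const_one, funext_iff, forall_and]
  rw [stringPairing_apply, Finset.sum_eq_single y, Finset.sum_eq_single x] at h3
  · simpa [h4] using h3
  · intro z _ hz
    simp [h4, hz.symm]
  · simp
  · intro z _ hz
    simp [h4, hz.symm]
  · simp

lemma opSupport_locPerm (hd : 1 ≤ d) {B : Finset (Op d)} (hB : IsOperatorBasis B)
    {σ : Perm (Fin t)} (h : locPerm d σ ≠ 0) :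
    opSupport B (locPerm d σ) = (σ.support : Set (Fin t)) := by
  ext i
  constructor
  · rintro ⟨P, hP, h1, h2⟩
    rw [stringSupport_eq hd hB hP h1] at h2
    exact h2
  · intro hi
    obtain ⟨P, hP, h1⟩ := exists_overlap_ne_zero hd hB h
    refine ⟨P, hP, h1, ?_⟩
    rw [stringSupport_eq hd hB hP h1]
    exact hi

end LocalizedPerm

end

theorem mainTheorem4 (t : ℕ) :
    -- counting sub-permutations
    ((∀ l : ℕ, (catalan l : ℚ) = (Nat.choose (2 * l) l : ℚ) / (l + 1) ∧
        catalan l ≤ Nat.factorial l) ∧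
      (∀ σ : Equiv.Perm (Fin t), σ.IsCycle →
        (LocalizedPerm.subPerms σ).card = catalan σ.support.card) ∧
      (∀ σ : Equiv.Perm (Fin t),
        (LocalizedPerm.subPerms σ).card = LocalizedPerm.catalanProd σ ∧
        LocalizedPerm.catalanProd σ ≤ catalan σ.support.card)) ∧
    -- counting blocks and their sizes
    ((∀ l : ℕ, (Finset.univ.filter fun Γ : Finset (Fin t) => Γ.card = l).card = Nat.choose t l) ∧
      (∀ Γ : Finset (Fin t),
        (Finset.univ.filter fun σ : Equiv.Perm (Fin t) => σ.support = Γ).card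
          = numDerangements Γ.card) ∧
      (∀ l : ℕ, 1 ≤ l →
        (numDerangements l : ℤ) = ⌊(Nat.factorial l : ℝ) / Real.exp 1 + 1 / 2⌋) ∧
      Nat.factorial t = ∑ l ∈ Finset.range (t + 1) \ {1}, Nat.choose t l * numDerangements l) ∧
    -- the change of basis matrix, which does not involve the dimension
    (IsPartialOrder (Equiv.Perm (Fin t)) LocalizedPerm.SubPerm ∧
      (∀ σ π : Equiv.Perm (Fin t), LocalizedPerm.phi t σ π =
        if LocalizedPerm.SubPerm π σ then LocalizedPerm.mobius (π⁻¹ * σ) else 0) ∧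
      (∀ σ : Equiv.Perm (Fin t), LocalizedPerm.phi t σ σ = 1) ∧
      (∃ e : Equiv.Perm (Fin t) ≃ Fin (Nat.factorial t),
        ∀ π σ : Equiv.Perm (Fin t), LocalizedPerm.SubPerm π σ → e π ≤ e σ) ∧
      (∀ e : Equiv.Perm (Fin t) ≃ Fin (Nat.factorial t),
        (∀ π σ : Equiv.Perm (Fin t), LocalizedPerm.SubPerm π σ → e π ≤ e σ) →
        ((LocalizedPerm.phi t).submatrix e.symm e.symm).BlockTriangular OrderDual.toDual) ∧
      LocalizedPerm.phi t * LocalizedPerm.zeta t = 1 ∧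
      LocalizedPerm.zeta t * LocalizedPerm.phi t = 1) ∧
    ∀ d : ℕ, 1 ≤ d →
      -- the two expansions, and their equivalence for every family of operators
      (∀ σ : Equiv.Perm (Fin t), LocalizedPerm.normPerm d σ =
        ∑ π ∈ LocalizedPerm.subPerms σ, LocalizedPerm.locPerm d π) ∧
      (∀ L : Equiv.Perm (Fin t) → LocalizedPerm.TOp t d,
        (∀ σ, LocalizedPerm.normPerm d σ = ∑ π ∈ LocalizedPerm.subPerms σ, L π) ↔
        (∀ σ, L σ = ∑ π ∈ LocalizedPerm.subPerms σ,
          (LocalizedPerm.phi t σ π : ℂ) • LocalizedPerm.normPerm d π)) ∧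
      Submodule.span ℂ (Set.range fun σ : Equiv.Perm (Fin t) => LocalizedPerm.locPerm d σ) =
        Submodule.span ℂ (Set.range fun σ : Equiv.Perm (Fin t) => LocalizedPerm.normPerm d σ) ∧
      -- linear independence and one-to-one correspondence
      (t ≤ d →
        LinearIndependent ℂ (fun σ : Equiv.Perm (Fin t) => LocalizedPerm.locPerm d σ) ∧
        Function.Injective (fun σ : Equiv.Perm (Fin t) => LocalizedPerm.locPerm d σ)) ∧
      -- definite support, for every orthonormal operator basis containing the identity
      (∀ B : Finset (LocalizedPerm.Op d), LocalizedPerm.IsOperatorBasis B →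
        ∀ σ : Equiv.Perm (Fin t),
          (∀ P : Fin t → LocalizedPerm.Op d, (∀ i, P i ∈ B) →
            LocalizedPerm.overlap (LocalizedPerm.tensorOp P) (LocalizedPerm.locPerm d σ) ≠ 0 →
            LocalizedPerm.stringSupport P = σ.support) ∧
          (2 ≤ d ∨ σ = 1 →
            LocalizedPerm.locPerm d σ ≠ 0 ∧
            LocalizedPerm.opSupport B (LocalizedPerm.locPerm d σ) = (σ.support : Set (Fin t)))) ∧
      -- orthogonality with respect to support, and the bound on the overlaps
      (Matrix.reindex
          (Equiv.sigmaFiberEquiv fun σ : Equiv.Perm (Fin t) => σ.support).symm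
          (Equiv.sigmaFiberEquiv fun σ : Equiv.Perm (Fin t) => σ.support).symm
          (LocalizedPerm.locGram t d) =
        Matrix.blockDiagonal' (LocalizedPerm.locGramBlock t d)) ∧
      (∀ σ π : Equiv.Perm (Fin t), σ.support ≠ π.support →
        LocalizedPerm.overlap (LocalizedPerm.locPerm d σ) (LocalizedPerm.locPerm d π) = 0) ∧
      (∀ σ π : Equiv.Perm (Fin t),
        ‖LocalizedPerm.overlap (LocalizedPerm.locPerm d σ) (LocalizedPerm.locPerm d π)‖ ≤
          (LocalizedPerm.catalanProd σ : ℝ) ^ 2 * (LocalizedPerm.catalanProd π : ℝ) ^ 2 *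
            (d : ℝ) ^ (LocalizedPerm.permSize σ + LocalizedPerm.permSize π) *
            (if σ.support = π.support then 1 else 0)) := by
  open LocalizedPerm in
  refine ⟨⟨fun l => ⟨catalan_eq_choose_div l, catalan_le_factorial l⟩,
      fun σ => card_subPerms_of_isCycle, fun σ => ⟨card_subPerms σ, catalanProd_le σ⟩⟩,
    ⟨card_filter_card_eq, card_filter_support_eq, numDerangements_eq_floor, factorial_eq_sum t⟩,
    ⟨isPartialOrder_subPerm, phi_apply, phi_self, exists_monotone_enumeration t,
      phi_blockTriangular, phi_mul_zeta t, zeta_mul_phi t⟩,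
    fun d hd => ⟨normPerm_eq_sum_locPerm, normPerm_eq_sum_iff, span_locPerm t d,
      fun h => ⟨linearIndependent_locPerm hd h, (linearIndependent_locPerm hd h).injective⟩,
      fun B hB σ => ⟨fun P hP h => stringSupport_eq hd hB hP h, fun h => ?_⟩,
      locGram_eq_blockDiagonal hd, fun σ π h => overlap_locPerm_eq_zero hd h, fun σ π => ?_⟩⟩
  · have hne : LocalizedPerm.locPerm d σ ≠ 0 := by
      rcases h with h | rfl
      exacts [LocalizedPerm.locPerm_ne_zero_of_two_le h σ, LocalizedPerm.locPerm_one_ne_zero hd]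
    exact ⟨hne, LocalizedPerm.opSupport_locPerm hd hB hne⟩
  · split_ifs with h
    · rw [mul_one]
      exact LocalizedPerm.norm_overlap_locPerm_le hd σ π
    · rw [LocalizedPerm.overlap_locPerm_eq_zero hd h, norm_zero, mul_zero]
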